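/- **Notation.** Let $Y$ be a $C^\infty$ manifold of dimension $n$ (Hausdorff, second countable, without boundary). $\mathcal D'(Y,\Omega^{1/2}(Y))$ denotes the space of half-density valued distributions, i.e. continuous linear forms on the compactly supported smooth half-densities. Let $\Lambda\subset T^*Y\setminus 0$ be a conic $C^\infty$ Lagrangian submanifold. For $m\in\mathbb R$, the class $I^m(Y,\Lambda,\Omega^{1/2}(Y))$ consists of all $A\in\mathcal D'(Y,\Omega^{1/2}(Y))$ such that every point of $Y$ has a neighbourhood on which, in suitable local coordinates $x\in\mathbb R^n$, $A$ is the sum of a $C^\infty$ half-density and of finitely many oscillatory integrals $$\int_{\mathbb R^N} e^{i\varphi(x,\theta)}\,a(x,\theta)\,d\theta\;|dx|^{1/2},\qquad a\in S^{\,m+(n-2N)/4}(\mathbb R^n\times\mathbb R^N),$$ where $\varphi$ is a real non-degenerate phase function in an open cone $\Gamma\subset\mathbb R^n\times(\mathbb R^N\setminus0)$ over the coordinate patch (smooth, positively homogeneous of degree one in $\theta$, $d\varphi\neq0$, and with $d(\partial_{\theta_1}\varphi),\dots,d(\partial_{\theta_N}\varphi)$ linearly independent where $d_\theta\varphi=0$)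 such that $\{(x,d_x\varphi): (x,\theta)\in\Gamma,\ d_\theta\varphi(x,\theta)=0\}\subset\Lambda$, and where $\operatorname{supp}a\subset\{(x,t\theta): t\ge1,\ (x,\theta)\in K\}$ for some compact $K\subset\Gamma$. Here $S^\mu(\mathbb R^n\times\mathbb R^N)$ is the class of $a\in C^\infty$ with $|\partial_x^\beta\partial_\theta^\alpha a|\le C_{\alpha,\beta,K'}(1+|\theta|)^{\mu-|\alpha|}$ for $x$ in any compact set $K'$; $N$, $\varphi$, $a$ may differ from term to term. **Proposition.** Let $X$ be a $C^\infty$ manifold of dimension $d$ (Hausdorff, second countable, without boundary), and let $\Lambda\subset(T^*\mathbb R\setminus0)\times(T^*X\setminus0)$ be a $C^\infty$ conic Lagrangian submanifold of $T^*(\mathbb R\times X)\setminus 0$ which is closed in $(T^*\mathbb R\setminus0)\times(T^*X\setminus0)$. Let $m\in\mathbb R$ and $A=A(s,y)\in I^m(\mathbb R\times X,\Lambda,\Omega^{1/2}(\mathbb R\times X))$. Let $A(s-s',y)$ denote the distributional half-density on $\mathbb R\times X\times\mathbb R$ that is the pull-back of $A\otimes|ds'|^{1/2}$ by the diffeomorphism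 $(s,y,s')\mapsto(s-s',y,s')$, and put $$\widetilde\Lambda=\{(s,\sigma,y,\eta,s',\sigma'): (s-s',\sigma,y,\eta)\in\Lambda,\ \sigma=-\sigma'\}\subset T^*(\mathbb R\times X\times\mathbb R).$$ Then $\widetilde\Lambda$ is a $C^\infty$ conic Lagrangian submanifold of $T^*(\mathbb R\times X\times\mathbb R)\setminus0$, it is contained and closed in $(T^*\mathbb R\setminus0)\times(T^*X\setminus0)\times(T^*\mathbb R\setminus0)$, it is closed in $T^*(\mathbb R\times X\times\mathbb R)\setminus0$ if $\Lambda$ is closed in $T^*(\mathbb R\times X)\setminus0$, and $$A(s-s',y)\in I^{m-\frac14}(\mathbb R\times X\times\mathbb R,\widetilde\Lambda,\Omega^{1/2}(\mathbb R\times X\times\mathbb R)).$$ -/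

import Mathlib

open Set Filter Topology MeasureTheory
open scoped ContDiff Manifold

namespace LagDist

/-! ### Smooth coordinate systems, half-densities and distributional half-densities

`M` is a manifold without boundary modelled on the finite-dimensional vector space `E`, which
carries a Lebesgue measure `volume`. -/

section Basic

variable {E : Type} [NormedAddCommGroup E] [NormedSpace ℝ E]
  {H : Type} [TopologicalSpace H] (I : ModelWithCorners ℝ E H)
  (M : Type*) [TopologicalSpace M] [ChartedSpace H M]

/-- A local coordinate system of `M`: a `C^∞` diffeomorphism from an open subset of `M` onto an
open subset of the vector space `E`. -/
structure Coord where
  /-- the underlying homeomorphism between open subsets -/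
  chart : OpenPartialHomeomorph M E
  smooth : ContMDiffOn I 𝓘(ℝ, E) ∞ chart chart.source
  smooth_symm : ContMDiffOn 𝓘(ℝ, E) I ∞ chart.symm chart.target

variable {I M}

/-- The local expression `f` of a half-density field vanishes outside `K ⊆ M`. The field is given
by its coefficients `f κ z` in all coordinate systems `κ`. -/
def VanishesOff (f : Coord I M → E → ℂ) (K : Set M) : Prop :=
  ∀ κ : Coord I M, ∀ z ∈ κ.chart.target, κ.chart.symm z ∉ K → f κ z = 0

/-- `f`, given by coefficient functions `f κ` on the range of every coordinate system `κ`
(extended by zero), is a `C^∞` half-density on `M`, that is a section of `Ω^{1/2}(M)`: in `κ` it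
is `f κ(z) |dz|^{1/2}`, and a change of coordinates `h = κ' ∘ κ⁻¹` gives
`f κ = |det Dh|^{1/2} f κ' ∘ h`. -/
structure IsHalfDensity (f : Coord I M → E → ℂ) : Prop where
  zero_off : ∀ κ : Coord I M, ∀ z ∉ κ.chart.target, f κ z = 0
  smooth : ∀ κ : Coord I M, ContDiffOn ℝ ∞ (f κ) κ.chart.target
  change : ∀ κ κ' : Coord I M, ∀ z ∈ κ.chart.target, κ.chart.symm z ∈ κ'.chart.source →
    f κ z = (Real.sqrt |(fderiv ℝ (κ'.chart ∘ κ.chart.symm) z).det| : ℝ) *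
      f κ' (κ'.chart (κ.chart.symm z))

variable (I M)

/-- The space `C_c^∞(M, Ω^{1/2})` of compactly supported smooth half-densities. -/
def TestHD : Submodule ℂ (Coord I M → E → ℂ) where
  carrier := {f | IsHalfDensity f ∧ ∃ K : Set M, IsCompact K ∧ VanishesOff f K}
  zero_mem' := by
    refine ⟨⟨fun _ _ _ => rfl, fun κ => contDiffOn_const, fun _ _ _ _ _ => by simp⟩,
      ∅, isCompact_empty, fun _ _ _ _ => rfl⟩
  add_mem' := by
    rintro f g ⟨hf, K, hK, hfK⟩ ⟨hg, L, hL, hgL⟩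
    refine ⟨⟨fun κ z hz => ?_, fun κ => (hf.smooth κ).add (hg.smooth κ),
      fun κ κ' z hz hz' => ?_⟩, K ∪ L, hK.union hL, fun κ z hz hz' => ?_⟩
    · simp [hf.zero_off κ z hz, hg.zero_off κ z hz]
    · simp only [Pi.add_apply, hf.change κ κ' z hz hz', hg.change κ κ' z hz hz', mul_add]
    · simp only [mem_union, not_or] at hz'
      simp [hfK κ z hz hz'.1, hgL κ z hz hz'.2]
  smul_mem' := by
    rintro c f ⟨hf, K, hK, hfK⟩
    refine ⟨⟨fun κ z hz => ?_, fun κ => (hf.smooth κ).const_smul c,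
      fun κ κ' z hz hz' => ?_⟩, K, hK, fun κ z hz hz' => ?_⟩
    · simp [hf.zero_off κ z hz]
    · simp only [Pi.smul_apply, smul_eq_mul, hf.change κ κ' z hz hz']
      ring
    · simp [hfK κ z hz hz']

/-- Distributional half-densities `D'(M, Ω^{1/2})`: linear forms on `C_c^∞(M, Ω^{1/2})` which, on
the half-densities supported in a given compact set, are bounded by finitely many of the
seminorms `φ ↦ sup_{z ∈ L} ‖D^j φ_κ(z)‖` with `L` compact in the range of `κ`. -/
structure DistHD where
  /-- the underlying linear form -/
  form : TestHD I M →ₗ[ℂ] ℂ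
  bounded : ∀ K : Set M, IsCompact K → ∃ (r k : ℕ) (κ : Fin r → Coord I M) (L : Fin r → Set E)
    (C : ℝ), (∀ i, IsCompact (L i) ∧ L i ⊆ (κ i).chart.target) ∧
      ∀ φ : TestHD I M, VanishesOff φ.1 K → ∀ B : ℝ, 0 ≤ B →
        (∀ i, ∀ j ≤ k, ∀ z ∈ L i, ‖iteratedFDeriv ℝ j (φ.1 (κ i)) z‖ ≤ B) →
        ‖form φ‖ ≤ C * B

end Basic

/-! ### Conic Lagrangian submanifolds of the cotangent bundle -/

section Cotangent

variable {E : Type} [NormedAddCommGroup E] [NormedSpace ℝ E]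
  {H : Type} [TopologicalSpace H] (I : ModelWithCorners ℝ E H)
  (M : Type*) [TopologicalSpace M] [ChartedSpace H M]

/-- The cotangent bundle `T*M`, as the set of pairs `(x, ξ)` with `ξ` a linear form on `T_xM`. -/
abbrev Cotangent := Σ x : M, (TangentSpace I x →L[ℝ] ℝ)

/-- `T*M ∖ 0`. -/
def nonzeroCotangent : Set (Cotangent I M) := {q | q.2 ≠ 0}

variable {I M}

/-- The expression of a subset of `T*M` in the canonical coordinates `(z, ζ) ∈ E × E*` induced by
the coordinate system `κ`: the point `(z, ζ)` stands for the covector `ζ ∘ Dκ` at `κ⁻¹(z)`. -/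
def inCoord (κ : Coord I M) (Λ : Set (Cotangent I M)) : Set (E × (E →L[ℝ] ℝ)) :=
  {p | p.1 ∈ κ.chart.target ∧
    (⟨κ.chart.symm p.1, p.2.comp (mfderiv I 𝓘(ℝ, E) κ.chart (κ.chart.symm p.1))⟩ :
      Cotangent I M) ∈ Λ}

/-- `Λ` is a subset of the open set `W ⊆ T*M` and is relatively closed in it (this is a local
property, expressed in a covering by coordinate systems). -/
def IsClosedIn (Λ W : Set (Cotangent I M)) : Prop :=
  Λ ⊆ W ∧ ∀ x : M, ∃ κ : Coord I M, x ∈ κ.chart.source ∧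
    ∀ p ∈ inCoord κ W, p ∈ closure (inCoord κ Λ) → p ∈ inCoord κ Λ

/-- Near `p`, the subset `S` of `E × E*` is a `C^∞` submanifold of dimension `dim E` (the zero set
of a submersion to `E`) on which the symplectic form `∑ dζ_j ∧ dz_j` vanishes. -/
def IsLagrangianNear (S : Set (E × (E →L[ℝ] ℝ))) (p : E × (E →L[ℝ] ℝ)) : Prop :=
  ∃ (W : Set (E × (E →L[ℝ] ℝ))) (f : E × (E →L[ℝ] ℝ) → E), IsOpen W ∧ p ∈ W ∧
    ContDiffOn ℝ ∞ f W ∧ (∀ q ∈ W, Function.Surjective (fderiv ℝ f q)) ∧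
    (∀ q ∈ W, q ∈ S ↔ f q = 0) ∧
    ∀ q ∈ W ∩ S, ∀ v w : E × (E →L[ℝ] ℝ), fderiv ℝ f q v = 0 → fderiv ℝ f q w = 0 →
      v.2 w.1 - w.2 v.1 = 0

/-- `Λ` is a conic `C^∞` Lagrangian submanifold of `T*M ∖ 0`. -/
structure IsConicLagrangian (Λ : Set (Cotangent I M)) : Prop where
  nonzero : Λ ⊆ nonzeroCotangent I M
  conic : ∀ (x : M) (ξ : TangentSpace I x →L[ℝ] ℝ) (t : ℝ), 0 < t →
    (⟨x, ξ⟩ : Cotangent I M) ∈ Λ → (⟨x, t • ξ⟩ : Cotangent I M) ∈ Λ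
  lagrangian : ∀ q ∈ Λ, ∃ κ : Coord I M, q.1 ∈ κ.chart.source ∧
    ∀ p ∈ inCoord κ Λ, κ.chart.symm p.1 = q.1 → IsLagrangianNear (inCoord κ Λ) p

end Cotangent

/-! ### Lagrangian distributions -/

section Lagrangian

variable {E : Type} [NormedAddCommGroup E] [NormedSpace ℝ E]

/-- The Hörmander symbol class `S^μ(E × ℝ^N)` (type `(1,0)`). -/
def IsSymbol {N : ℕ} (μ : ℝ) (a : E × EuclideanSpace ℝ (Fin N) → ℂ) : Prop :=
  ContDiff ℝ ∞ a ∧ ∀ K : Set E, IsCompact K → ∀ j k : ℕ, ∃ C : ℝ, ∀ x ∈ K, ∀ θ,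
    ‖iteratedFDeriv ℝ j (fun x' => iteratedFDeriv ℝ k (fun θ' => a (x', θ')) θ) x‖
      ≤ C * (1 + ‖θ‖) ^ (μ - k)

/-- The differential `d_θ φ` with respect to the fibre variables `θ`. -/
noncomputable def dTheta {N : ℕ} (φ : E × EuclideanSpace ℝ (Fin N) → ℝ)
    (p : E × EuclideanSpace ℝ (Fin N)) : EuclideanSpace ℝ (Fin N) →L[ℝ] ℝ :=
  (fderiv ℝ φ p).comp (ContinuousLinearMap.inr ℝ E (EuclideanSpace ℝ (Fin N)))

/-- The differential `d_x φ` with respect to the base variables `x`. -/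
noncomputable def dBase {N : ℕ} (φ : E × EuclideanSpace ℝ (Fin N) → ℝ)
    (p : E × EuclideanSpace ℝ (Fin N)) : E →L[ℝ] ℝ :=
  (fderiv ℝ φ p).comp (ContinuousLinearMap.inl ℝ E (EuclideanSpace ℝ (Fin N)))

/-- `φ` is a non-degenerate phase function in the open cone `Γ ⊆ E × (ℝ^N ∖ 0)`: it is smooth,
positively homogeneous of degree one in `θ`, without critical points, and the differentials
`d(∂φ/∂θ_j)`, `j = 1, …, N`, are linearly independent where `d_θ φ = 0`. -/
structure IsNondegeneratePhase {N : ℕ} (Γ : Set (E × EuclideanSpace ℝ (Fin N)))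
    (φ : E × EuclideanSpace ℝ (Fin N) → ℝ) : Prop where
  isOpen : IsOpen Γ
  ne_zero : ∀ p ∈ Γ, p.2 ≠ 0
  conic : ∀ p ∈ Γ, ∀ t : ℝ, 0 < t → (p.1, t • p.2) ∈ Γ
  smooth : ContDiffOn ℝ ∞ φ Γ
  homogeneous : ∀ p ∈ Γ, ∀ t : ℝ, 0 < t → φ (p.1, t • p.2) = t * φ p
  no_critical : ∀ p ∈ Γ, fderiv ℝ φ p ≠ 0
  nondegenerate : ∀ p ∈ Γ, dTheta φ p = 0 → Function.Surjective (fderiv ℝ (dTheta φ) p)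

/-- The number `c` is the oscillatory integral `∬ e^{iφ(x,θ)} a(x,θ) u(x) dx dθ`, that is, the
limit as `ε → 0+` of the integrals with the additional factor `χ(εθ)`, for every cut-off function
`χ ∈ C_c^∞(ℝ^N)` with `χ(0) = 1`. -/
def IsOscillatoryIntegral [MeasureSpace E] {N : ℕ}
    (φ : E × EuclideanSpace ℝ (Fin N) → ℝ) (a : E × EuclideanSpace ℝ (Fin N) → ℂ)
    (u : E → ℂ) (c : ℂ) : Prop :=
  ∀ χ : EuclideanSpace ℝ (Fin N) → ℝ, ContDiff ℝ ∞ χ → HasCompactSupport χ → χ 0 = 1 →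
    Tendsto (fun ε : ℝ => ∫ θ : EuclideanSpace ℝ (Fin N), ∫ x : E,
      Complex.exp (Complex.I * (φ (x, θ) : ℂ)) * (χ (ε • θ) : ℂ) * a (x, θ) * u x)
      (𝓝[>] 0) (𝓝 c)

variable {H : Type} [TopologicalSpace H] {I : ModelWithCorners ℝ E H}
  {M : Type*} [TopologicalSpace M] [ChartedSpace H M]

/-- `(φ, a)` are the phase and the amplitude, in the coordinates `κ`, of an oscillatory integral of
order `m` attached to `Λ`: `φ` is a non-degenerate phase function in an open cone `Γ` over the
range of `κ`, the Lagrangian `{(x, d_xφ) : d_θφ = 0}` that it parametrizes is a part of `Λ`,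
`a ∈ S^{m + (n - 2N)/4}` with `n = dim M`, and the support of `a` lies in
`{(x, tθ) : t ≥ 1, (x, θ) ∈ K}` for some compact `K ⊆ Γ`. -/
def IsLagrangianAmplitude (κ : Coord I M) (m : ℝ) (Λ : Set (Cotangent I M)) (N : ℕ)
    (φ : E × EuclideanSpace ℝ (Fin N) → ℝ) (a : E × EuclideanSpace ℝ (Fin N) → ℂ) : Prop :=
  ∃ Γ : Set (E × EuclideanSpace ℝ (Fin N)),
    IsNondegeneratePhase Γ φ ∧ (∀ p ∈ Γ, p.1 ∈ κ.chart.target) ∧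
    (∀ p ∈ Γ, dTheta φ p = 0 → (p.1, dBase φ p) ∈ inCoord κ Λ) ∧
    IsSymbol (m + ((Module.finrank ℝ E : ℝ) - 2 * N) / 4) a ∧
    ∃ K : Set (E × EuclideanSpace ℝ (Fin N)), IsCompact K ∧ K ⊆ Γ ∧
      ∀ p, a p ≠ 0 → ∃ q ∈ K, ∃ t : ℝ, 1 ≤ t ∧ p = (q.1, t • q.2)

/-- The class `I^m(M, Λ, Ω^{1/2}(M))` of Lagrangian distributions of order `m`: near every point,
in suitable local coordinates, `A` is the sum of finitely many oscillatory integrals of order `m`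
attached to `Λ` and of a `C^∞` half-density `g |dz|^{1/2}`. (The normalizing factors
`(2π)^{-(n+2N)/4}` are absorbed in the amplitudes.) -/
def MemLagrangian [MeasureSpace E] (m : ℝ) (Λ : Set (Cotangent I M)) (A : DistHD I M) : Prop :=
  ∀ x₀ : M, ∃ (κ : Coord I M) (U : Set M), IsOpen U ∧ x₀ ∈ U ∧ U ⊆ κ.chart.source ∧
    ∃ (r : ℕ) (N : Fin r → ℕ) (φ : (i : Fin r) → E × EuclideanSpace ℝ (Fin (N i)) → ℝ)
      (a : (i : Fin r) → E × EuclideanSpace ℝ (Fin (N i)) → ℂ) (g : E → ℂ),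
      (∀ i, IsLagrangianAmplitude κ m Λ (N i) (φ i) (a i)) ∧
      ContDiffOn ℝ ∞ g κ.chart.target ∧
      ∀ u : TestHD I M, (∃ K ⊆ U, IsCompact K ∧ VanishesOff u.1 K) →
        ∃ c : Fin r → ℂ, (∀ i, IsOscillatoryIntegral (φ i) (a i) (u.1 κ) (c i)) ∧
          A.form u = ∑ i, c i + ∫ z : E, g z * u.1 κ z

end Lagrangian

/-! ### The pull-back `A(s, y) ↦ A(s - s', y)` -/

section Translate

/-- `E_d = ℝ^d`. -/
abbrev Ed (d : ℕ) := EuclideanSpace ℝ (Fin d)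

/-- The model of `ℝ × X`, `dim X = d`. -/
noncomputable abbrev I₂ (d : ℕ) :
    ModelWithCorners ℝ (ℝ × Ed d) (ModelProd ℝ (Ed d)) := 𝓘(ℝ, ℝ).prod (𝓡 d)

/-- The model of `ℝ × X × ℝ`, `dim X = d`. -/
noncomputable abbrev I₃ (d : ℕ) :
    ModelWithCorners ℝ ((ℝ × Ed d) × ℝ) (ModelProd (ModelProd ℝ (Ed d)) ℝ) :=
  (I₂ d).prod 𝓘(ℝ, ℝ)

variable {d : ℕ} {X : Type*} [TopologicalSpace X] [ChartedSpace (Ed d) X]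

/-- The diffeomorphism `(s, y, s') ↦ (s - s', y, s')` of `ℝ × X × ℝ`. -/
def shear (X : Type*) [TopologicalSpace X] : ((ℝ × X) × ℝ) ≃ₜ ((ℝ × X) × ℝ) where
  toFun p := ((p.1.1 - p.2, p.1.2), p.2)
  invFun p := ((p.1.1 + p.2, p.1.2), p.2)
  left_inv p := by simp
  right_inv p := by simp
  continuous_toFun := by fun_prop
  continuous_invFun := by fun_prop

/-- A coordinate system `κ` of `ℝ × X` gives the coordinate system
`(s, y, s') ↦ (κ(s - s', y), s')` of `ℝ × X × ℝ`. -/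
noncomputable def Coord.pull (κ : Coord (I₂ d) (ℝ × X)) : Coord (I₃ d) ((ℝ × X) × ℝ) where
  chart := (shear X).transOpenPartialHomeomorph
    (κ.chart.prod (OpenPartialHomeomorph.refl ℝ))
  smooth := by
    have h1 : ContMDiff (I₃ d) (I₂ d) ∞ (fun p : (ℝ × X) × ℝ => (p.1.1 - p.2, p.1.2)) :=
      ((contMDiff_fst.comp contMDiff_fst).sub contMDiff_snd).prodMk
        (contMDiff_snd.comp contMDiff_fst)
    refine ContMDiffOn.prodMk_space (κ.smooth.comp h1.contMDiffOn ?_) contMDiff_snd.contMDiffOn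
    intro p hp
    exact (show _ ∧ _ from hp).1
  smooth_symm := by
    have h0 : ContMDiffOn 𝓘(ℝ, (ℝ × Ed d) × ℝ) (I₂ d) ∞
        (fun q : (ℝ × Ed d) × ℝ => κ.chart.symm q.1) (κ.chart.target ×ˢ univ) :=
      κ.smooth_symm.comp contDiff_fst.contMDiff.contMDiffOn (fun q hq => hq.1)
    have h2 : ContMDiffOn 𝓘(ℝ, (ℝ × Ed d) × ℝ) 𝓘(ℝ, ℝ) ∞
        (fun q : (ℝ × Ed d) × ℝ => q.2) (κ.chart.target ×ˢ univ) :=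
      contDiff_snd.contMDiff.contMDiffOn
    have h3 := (((contMDiff_fst.comp_contMDiffOn h0).add h2).prodMk
      (contMDiff_snd.comp_contMDiffOn h0)).prodMk h2
    exact h3

theorem Coord.mem_pull_target (κ : Coord (I₂ d) (ℝ × X)) (z : ℝ × Ed d) (t : ℝ) :
    (z, t) ∈ κ.pull.chart.target ↔ z ∈ κ.chart.target := by
  change z ∈ κ.chart.target ∧ t ∈ univ ↔ _
  simp

theorem Coord.pull_symm_apply (κ : Coord (I₂ d) (ℝ × X)) (z : ℝ × Ed d) (t : ℝ) :
    κ.pull.chart.symm (z, t) = (shear X).symm (κ.chart.symm z, t) := rfl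

theorem Coord.pull_apply (κ : Coord (I₂ d) (ℝ × X)) (p : (ℝ × X) × ℝ) :
    κ.pull.chart p = (κ.chart (shear X p).1, p.2) := rfl

/-- The function `z ↦ ∫ F(z, s') ds'`. -/
noncomputable def fibreInt {E F : Type} [NormedAddCommGroup F] [NormedSpace ℝ F]
    (f : E × ℝ → F) (z : E) : F := ∫ t : ℝ, f (z, t)

section FibreInt

set_option linter.unusedSectionVars false

variable {E F : Type} [NormedAddCommGroup E] [NormedSpace ℝ E]
  [NormedAddCommGroup F] [NormedSpace ℝ F]

theorem fibreInt_eq_convolution (f : E × ℝ → F) (z : E) :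
    fibreInt f z = MeasureTheory.convolution (fun _ : ℝ => (1 : ℝ)) (fun t => f (z, t))
      (ContinuousLinearMap.lsmul ℝ ℝ) volume 0 := by
  simp only [fibreInt, MeasureTheory.convolution, ContinuousLinearMap.lsmul_apply, one_smul,
    zero_sub]
  exact (integral_neg_eq_self (fun t => f (z, t)) volume).symm

theorem contDiffOn_fibreInt [CompleteSpace F] {U : Set E} (hU : IsOpen U) {k : Set ℝ}
    (hk : IsCompact k) {f : E × ℝ → F} (hf : ContDiffOn ℝ ∞ f (U ×ˢ univ))
    (h0 : ∀ z ∈ U, ∀ t ∉ k, f (z, t) = 0) : ContDiffOn ℝ ∞ (fibreInt f) U := by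
  have h := contDiffOn_convolution_right_with_param (μ := (volume : Measure ℝ))
    (n := (⊤ : ℕ∞)) (f := fun _ : ℝ => (1 : ℝ)) (ContinuousLinearMap.lsmul ℝ ℝ)
    (g := fun z t => f (z, t)) hU hk (fun p x hp hx => h0 p hp x hx)
    (continuous_const.locallyIntegrable) hf
  have h' := h.comp (contDiffOn_id.prodMk (contDiffOn_const (c := (0 : ℝ))))
    (s := U) (fun z hz => ⟨hz, mem_univ _⟩)
  refine h'.congr (fun z hz => ?_)
  exact fibreInt_eq_convolution f z

theorem fderiv_eq_zero_of_fibre {U : Set E} (hU : IsOpen U) {k : Set ℝ}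
    (hk : IsCompact k) {f : E × ℝ → F} (h0 : ∀ z ∈ U, ∀ t ∉ k, f (z, t) = 0) {z : E} (hz : z ∈ U)
    {t : ℝ} (ht : t ∉ k) : fderiv ℝ f (z, t) = 0 := by
  refine (hasFDerivAt_zero_of_eventually_const 0 ?_).fderiv
  filter_upwards [(hU.prod hk.isClosed.isOpen_compl).mem_nhds
    (show (z, t) ∈ U ×ˢ kᶜ from ⟨hz, ht⟩)]
  rintro ⟨w, r⟩ ⟨hw, hr⟩
  exact h0 w hw r hr

theorem integrable_of_fibre {U : Set E} {k : Set ℝ}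
    (hk : IsCompact k) {f : E × ℝ → F} (hf : ContinuousOn f (U ×ˢ univ))
    (h0 : ∀ z ∈ U, ∀ t ∉ k, f (z, t) = 0) {z : E} (hz : z ∈ U) :
    Integrable (fun t => f (z, t)) (volume : Measure ℝ) := by
  refine Continuous.integrable_of_hasCompactSupport ?_ (HasCompactSupport.intro hk (h0 z hz))
  exact hf.comp_continuous (.prodMk_right _) (fun t => ⟨hz, mem_univ t⟩)

theorem hasFDerivAt_fibreInt [CompleteSpace F] {U : Set E} (hU : IsOpen U) {k : Set ℝ}
    (hk : IsCompact k) {f : E × ℝ → F} (hf : ContDiffOn ℝ ∞ f (U ×ˢ univ))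
    (h0 : ∀ z ∈ U, ∀ t ∉ k, f (z, t) = 0) {z : E} (hz : z ∈ U) :
    HasFDerivAt (fibreInt f)
      (fibreInt (fun p => (fderiv ℝ f p).comp (ContinuousLinearMap.inl ℝ E ℝ)) z) z := by
  have h := hasFDerivAt_convolution_right_with_param (μ := (volume : Measure ℝ))
    (f := fun _ : ℝ => (1 : ℝ)) (ContinuousLinearMap.lsmul ℝ ℝ)
    (g := fun z t => f (z, t)) hU hk (fun p x hp hx => h0 p hp x hx)
    (continuous_const.locallyIntegrable) (hf.of_le (by norm_cast)) (z, 0) hz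
  have h' := h.comp z (hasFDerivAt_prodMk_left (𝕜 := ℝ) z (0 : ℝ))
  have e1 : ((fun q : E × ℝ => MeasureTheory.convolution (fun _ : ℝ => (1 : ℝ))
      (fun t => f (q.1, t)) (ContinuousLinearMap.lsmul ℝ ℝ) volume q.2) ∘ fun e => (e, (0 : ℝ)))
      = fibreInt f := by
    funext w
    exact (fibreInt_eq_convolution f w).symm
  have hc : ContinuousOn (fderiv ℝ f) (U ×ˢ univ) :=
    hf.continuousOn_fderiv_of_isOpen (hU.prod isOpen_univ) (by norm_cast)
  have hi := integrable_of_fibre (f := fderiv ℝ f) hk hc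
    (fun z hz t ht => fderiv_eq_zero_of_fibre hU hk h0 hz ht) hz
  have e2 : (MeasureTheory.convolution (fun _ : ℝ => (1 : ℝ)) (fun t => fderiv ℝ f (z, t))
      ((ContinuousLinearMap.lsmul ℝ ℝ : ℝ →L[ℝ] F →L[ℝ] F).precompR (E × ℝ)) volume 0)
      = fibreInt (fderiv ℝ f) z := by
    have : ∀ (T : E × ℝ →L[ℝ] F),
      ((ContinuousLinearMap.lsmul ℝ ℝ : ℝ →L[ℝ] F →L[ℝ] F).precompR (E × ℝ)) 1 T = T := by
      intro T
      ext v <;> simp [ContinuousLinearMap.precompR]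
    simp only [fibreInt, MeasureTheory.convolution, this, zero_sub]
    exact integral_neg_eq_self (fun t => fderiv ℝ f (z, t)) volume
  have e3 : (fibreInt (fderiv ℝ f) z).comp (ContinuousLinearMap.inl ℝ E ℝ)
      = fibreInt (fun p => (fderiv ℝ f p).comp (ContinuousLinearMap.inl ℝ E ℝ)) z := by
    simp only [fibreInt]
    exact (((ContinuousLinearMap.compL ℝ E (E × ℝ) F).flip
      (ContinuousLinearMap.inl ℝ E ℝ)).integral_comp_comm hi).symm
  rw [← e3, ← e2]
  rw [← e1]
  exact h'

theorem norm_iteratedFDeriv_fibreInt_le {U : Set E} (hU : IsOpen U) {R : ℝ} (hR : 0 ≤ R) (j : ℕ) :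
    ∀ {F : Type} [NormedAddCommGroup F] [NormedSpace ℝ F] [CompleteSpace F]
    {f : E × ℝ → F} (_ : ContDiffOn ℝ ∞ f (U ×ˢ univ))
    (_ : ∀ z ∈ U, ∀ t ∉ Icc (-R) R, f (z, t) = 0) {z : E} (_ : z ∈ U) {B : ℝ}
    (_ : ∀ t ∈ Icc (-R) R, ‖iteratedFDeriv ℝ j f (z, t)‖ ≤ B),
    ‖iteratedFDeriv ℝ j (fibreInt f) z‖ ≤ 2 * R * B := by
  induction j with
  | zero =>
    intro F _ _ _ f hf h0 z hz B hB
    simp only [norm_iteratedFDeriv_zero] at hB ⊢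
    rw [fibreInt, ← setIntegral_eq_integral_of_forall_compl_eq_zero (s := Icc (-R) R) (h0 z hz)]
    refine (norm_setIntegral_le_of_norm_le_const (by simp) hB).trans (le_of_eq ?_)
    rw [Real.volume_real_Icc_of_le (by linarith)]
    ring
  | succ j ih =>
    intro F _ _ _ f hf h0 z hz B hB
    have hV : IsOpen (U ×ˢ (univ : Set ℝ)) := hU.prod isOpen_univ
    have hf' : ContDiffOn ℝ ∞ (fderiv ℝ f) (U ×ˢ univ) :=
      hf.fderiv_of_isOpen hV (by norm_cast)
    let L : (E × ℝ →L[ℝ] F) →L[ℝ] (E →L[ℝ] F) :=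
      (ContinuousLinearMap.compL ℝ E (E × ℝ) F).flip (ContinuousLinearMap.inl ℝ E ℝ)
    have hL : ‖L‖ ≤ 1 := by
      refine ContinuousLinearMap.opNorm_le_bound _ zero_le_one fun T => ?_
      rw [one_mul]
      refine (ContinuousLinearMap.opNorm_comp_le T (ContinuousLinearMap.inl ℝ E ℝ)).trans ?_
      exact mul_le_of_le_one_right (norm_nonneg _) (ContinuousLinearMap.norm_inl_le_one ℝ E ℝ)
    have hev : fderiv ℝ (fibreInt f) =ᶠ[𝓝 z] fibreInt (L ∘ fderiv ℝ f) := by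
      filter_upwards [hU.mem_nhds hz] with w hw
      exact (hasFDerivAt_fibreInt hU isCompact_Icc hf h0 hw).fderiv
    rw [← norm_iteratedFDeriv_fderiv, (hev.iteratedFDeriv (𝕜 := ℝ) j).eq_of_nhds]
    refine ih (L.contDiff.comp_contDiffOn hf') (fun w hw t ht => ?_) hz (fun t ht => ?_)
    · simp [fderiv_eq_zero_of_fibre hU isCompact_Icc h0 hw ht]
    · have hc : ContDiffAt ℝ ∞ (fderiv ℝ f) (z, t) :=
        hf'.contDiffAt (hV.mem_nhds ⟨hz, mem_univ t⟩)
      refine (L.norm_iteratedFDeriv_comp_left hc (by norm_cast; exact le_top)).trans ?_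
      refine (mul_le_of_le_one_left (norm_nonneg _) hL).trans ?_
      rw [norm_iteratedFDeriv_fderiv]
      exact hB t ht

end FibreInt

theorem exists_fibre_bound {K : Set ((ℝ × X) × ℝ)} (hK : IsCompact K) :
    ∃ R : ℝ, 0 ≤ R ∧ ∀ ψ : Coord (I₃ d) ((ℝ × X) × ℝ) → (ℝ × Ed d) × ℝ → ℂ, VanishesOff ψ K →
      ∀ (κ : Coord (I₂ d) (ℝ × X)), ∀ z ∈ κ.chart.target, ∀ t ∉ Icc (-R) R,
        ψ κ.pull (z, t) = 0 := by
  obtain ⟨R, hR⟩ := (hK.image continuous_snd).isBounded.subset_closedBall (0 : ℝ)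
  refine ⟨max R 0, le_max_right _ _, fun ψ hψ κ z hz t ht => ?_⟩
  refine hψ κ.pull (z, t) ((κ.mem_pull_target z t).2 hz) (fun hmem => ht ?_)
  have h := hR ⟨_, hmem, rfl⟩
  rw [κ.pull_symm_apply] at h
  have h' : |t| ≤ R := by simpa [shear] using h
  have := abs_le.1 (h'.trans (le_max_left R 0))
  exact this

theorem isHalfDensity_fibreInt {ψ : Coord (I₃ d) ((ℝ × X) × ℝ) → (ℝ × Ed d) × ℝ → ℂ}
    (hψ : IsHalfDensity ψ) {K : Set ((ℝ × X) × ℝ)} (hK : IsCompact K) (hψK : VanishesOff ψ K) :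
    IsHalfDensity (fun κ : Coord (I₂ d) (ℝ × X) => fibreInt (ψ κ.pull)) := by
  obtain ⟨R, hR, hRψ⟩ := exists_fibre_bound (d := d) hK
  have htar : ∀ κ : Coord (I₂ d) (ℝ × X), κ.pull.chart.target = κ.chart.target ×ˢ univ := by
    intro κ
    ext ⟨z, t⟩
    simp [κ.mem_pull_target]
  refine ⟨fun κ z hz => ?_, fun κ => ?_, fun κ κ' z hz hz' => ?_⟩
  · have : ∀ t, ψ κ.pull (z, t) = 0 := fun t =>
      hψ.zero_off _ _ (fun h => hz ((κ.mem_pull_target z t).1 h))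
    simp [fibreInt, this]
  · refine contDiffOn_fibreInt κ.chart.open_target (isCompact_Icc (a := -R) (b := R)) ?_
      (hRψ ψ hψK κ)
    rw [← htar]
    exact hψ.smooth κ.pull
  · simp only [fibreInt]
    rw [← integral_const_mul]
    congr 1
    funext t
    have hcomp : (κ'.pull.chart ∘ κ.pull.chart.symm : (ℝ × Ed d) × ℝ → (ℝ × Ed d) × ℝ)
        = Prod.map (κ'.chart ∘ κ.chart.symm) id := by
      funext ⟨w, r⟩
      simp [κ.pull_symm_apply, κ'.pull_apply, Prod.map, shear]
    have hsrc : κ.pull.chart.symm (z, t) ∈ κ'.pull.chart.source := by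
      change (shear X) ((shear X).symm (κ.chart.symm z, t)) ∈ κ'.chart.source ×ˢ univ
      simpa using hz'
    have hval : κ'.pull.chart (κ.pull.chart.symm (z, t)) = (κ'.chart (κ.chart.symm z), t) :=
      congrFun hcomp (z, t)
    have hdiff : DifferentiableAt ℝ (κ'.chart ∘ κ.chart.symm) z := by
      have h1 : ContMDiffAt 𝓘(ℝ, ℝ × Ed d) 𝓘(ℝ, ℝ × Ed d) ∞ (κ'.chart ∘ κ.chart.symm) z :=
        (κ'.smooth.contMDiffAt (κ'.chart.open_source.mem_nhds hz')).comp z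
          (κ.smooth_symm.contMDiffAt (κ.chart.open_target.mem_nhds hz))
      exact h1.contDiffAt.differentiableAt (by simp)
    have hfd : fderiv ℝ (Prod.map (κ'.chart ∘ κ.chart.symm) (id : ℝ → ℝ)) (z, t)
        = (fderiv ℝ (κ'.chart ∘ κ.chart.symm) z).prodMap (ContinuousLinearMap.id ℝ ℝ) :=
      (hdiff.hasFDerivAt.prodMap (z, t) (hasFDerivAt_id t)).fderiv
    rw [hψ.change κ.pull κ'.pull (z, t) ((κ.mem_pull_target z t).2 hz) hsrc, hval, hcomp, hfd]
    have hdet : ((fderiv ℝ (κ'.chart ∘ κ.chart.symm) z).prodMap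
        (ContinuousLinearMap.id ℝ ℝ)).det = (fderiv ℝ (κ'.chart ∘ κ.chart.symm) z).det := by
      have := LinearMap.det_prodMap
        (fderiv ℝ (κ'.chart ∘ κ.chart.symm) z : (ℝ × Ed d) →ₗ[ℝ] (ℝ × Ed d))
        (LinearMap.id : ℝ →ₗ[ℝ] ℝ)
      rw [LinearMap.det_id, mul_one] at this
      exact this
    rw [hdet]

theorem vanishesOff_fibreInt {ψ : Coord (I₃ d) ((ℝ × X) × ℝ) → (ℝ × Ed d) × ℝ → ℂ}
    {K : Set ((ℝ × X) × ℝ)} (hψK : VanishesOff ψ K) :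
    VanishesOff (fun κ : Coord (I₂ d) (ℝ × X) => fibreInt (ψ κ.pull))
      ((fun p => (shear X p).1) '' K) := by
  intro κ z hz hz'
  have : ∀ t, ψ κ.pull (z, t) = 0 := fun t => by
    refine hψK κ.pull (z, t) ((κ.mem_pull_target z t).2 hz) (fun h => hz' ⟨_, h, ?_⟩)
    simp [κ.pull_symm_apply]
  simp [fibreInt, this]

/-- The push-forward of half-densities `ψ(s, y, s') |ds dy ds'|^{1/2} ↦
(∫ ψ(s + s', y, s') ds') |ds dy|^{1/2}` from `C_c^∞(ℝ × X × ℝ, Ω^{1/2})` to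
`C_c^∞(ℝ × X, Ω^{1/2})`; it is the transpose of `A(s, y) ↦ A(s - s', y)`. -/
noncomputable def pushTest (d : ℕ) (X : Type*) [TopologicalSpace X] [ChartedSpace (Ed d) X] :
    TestHD (I₃ d) ((ℝ × X) × ℝ) →ₗ[ℂ] TestHD (I₂ d) (ℝ × X) where
  toFun ψ := ⟨fun κ => fibreInt (ψ.1 κ.pull), by
    obtain ⟨ψ, hψ, K, hK, hψK⟩ := ψ
    exact ⟨isHalfDensity_fibreInt hψ hK hψK, _, hK.image (by fun_prop),
      vanishesOff_fibreInt hψK⟩⟩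
  map_add' := by
    have key : ∀ (ψ : TestHD (I₃ d) ((ℝ × X) × ℝ)) (κ : Coord (I₂ d) (ℝ × X)) (z : ℝ × Ed d),
        Integrable (fun t => ψ.1 κ.pull (z, t)) (volume : Measure ℝ) := by
      rintro ⟨ψ, hψ, K, hK, hψK⟩ κ z
      by_cases hz : z ∈ κ.chart.target
      · obtain ⟨R, hR, hRψ⟩ := exists_fibre_bound (d := d) hK
        refine integrable_of_fibre (U := κ.chart.target) (isCompact_Icc (a := -R) (b := R)) ?_
          (hRψ ψ hψK κ) hz
        refine (hψ.smooth κ.pull).continuousOn.mono ?_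
        rintro ⟨w, t⟩ ⟨hw, -⟩
        exact (κ.mem_pull_target w t).2 hw
      · have : ∀ t, ψ κ.pull (z, t) = 0 := fun t =>
          hψ.zero_off _ _ (fun h => hz ((κ.mem_pull_target z t).1 h))
        simp [this]
    intro ψ ψ'
    ext κ z
    exact integral_add (key ψ κ z) (key ψ' κ z)
  map_smul' := by
    intro c ψ
    ext κ z
    exact integral_const_mul c _

/-- The distributional half-density `A(s - s', y)` on `ℝ × X × ℝ`: the pull-back of
`A ⊗ |ds'|^{1/2}` by the diffeomorphism `(s, y, s') ↦ (s - s', y, s')`. -/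
noncomputable def translate (A : DistHD (I₂ d) (ℝ × X)) : DistHD (I₃ d) ((ℝ × X) × ℝ) where
  form := A.form ∘ₗ pushTest d X
  bounded := by
    intro K hK
    obtain ⟨r, k, κ, L, C, hL, hA⟩ := A.bounded ((fun p => (shear X p).1) '' K)
      (hK.image (by fun_prop))
    obtain ⟨R, hR, hRψ⟩ := exists_fibre_bound (d := d) hK
    refine ⟨r, k, fun i => (κ i).pull, fun i => L i ×ˢ Icc (-R) R, C * (2 * R),
      fun i => ⟨(hL i).1.prod isCompact_Icc, ?_⟩, fun φ hφ B hB hbd => ?_⟩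
    · rintro ⟨z, t⟩ ⟨hz, -⟩
      exact ((κ i).mem_pull_target z t).2 ((hL i).2 hz)
    · rw [mul_assoc]
      refine hA (pushTest d X φ) (vanishesOff_fibreInt hφ) (2 * R * B) (by positivity)
        (fun i j hj z hz => ?_)
      refine norm_iteratedFDeriv_fibreInt_le (κ i).chart.open_target hR j ?_ (hRψ φ.1 hφ (κ i))
        ((hL i).2 hz) (fun t ht => hbd i j hj (z, t) ⟨hz, ht⟩)
      refine (φ.2.1.smooth (κ i).pull).mono ?_
      rintro ⟨w, t⟩ ⟨hw, -⟩
      exact ((κ i).mem_pull_target w t).2 hw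

/-- The covector `σ ds + η` at the point `(s, y)` of `ℝ × X`. -/
noncomputable def covector₂ (s : ℝ) (σ : ℝ) (y : X) (η : TangentSpace (𝓡 d) y →L[ℝ] ℝ) :
    Cotangent (I₂ d) (ℝ × X) :=
  ⟨(s, y), (σ • ContinuousLinearMap.fst ℝ ℝ (Ed d) +
    ContinuousLinearMap.comp (show Ed d →L[ℝ] ℝ from η) (ContinuousLinearMap.snd ℝ ℝ (Ed d)) :
      ℝ × Ed d →L[ℝ] ℝ)⟩

/-- The covector `σ ds + η + σ' ds'` at the point `(s, y, s')` of `ℝ × X × ℝ`. -/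
noncomputable def covector₃ (s : ℝ) (σ : ℝ) (y : X) (η : TangentSpace (𝓡 d) y →L[ℝ] ℝ)
    (s' : ℝ) (σ' : ℝ) : Cotangent (I₃ d) ((ℝ × X) × ℝ) :=
  ⟨((s, y), s'), (ContinuousLinearMap.comp
      (σ • ContinuousLinearMap.fst ℝ ℝ (Ed d) +
        ContinuousLinearMap.comp (show Ed d →L[ℝ] ℝ from η) (ContinuousLinearMap.snd ℝ ℝ (Ed d)))
      (ContinuousLinearMap.fst ℝ (ℝ × Ed d) ℝ) +
    σ' • ContinuousLinearMap.snd ℝ (ℝ × Ed d) ℝ : (ℝ × Ed d) × ℝ →L[ℝ] ℝ)⟩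

/-- `(T*ℝ ∖ 0) × (T*X ∖ 0)`, as a subset of `T*(ℝ × X)`. -/
def nonzero₂ (d : ℕ) (X : Type*) [TopologicalSpace X] [ChartedSpace (Ed d) X] :
    Set (Cotangent (I₂ d) (ℝ × X)) :=
  {q | ∃ s σ, ∃ (y : X) (η : TangentSpace (𝓡 d) y →L[ℝ] ℝ), σ ≠ 0 ∧ η ≠ 0 ∧
    q = covector₂ s σ y η}

/-- `(T*ℝ ∖ 0) × (T*X ∖ 0) × (T*ℝ ∖ 0)`, as a subset of `T*(ℝ × X × ℝ)`. -/
def nonzero₃ (d : ℕ) (X : Type*) [TopologicalSpace X] [ChartedSpace (Ed d) X] :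
    Set (Cotangent (I₃ d) ((ℝ × X) × ℝ)) :=
  {q | ∃ s σ, ∃ (y : X) (η : TangentSpace (𝓡 d) y →L[ℝ] ℝ), ∃ s' σ', σ ≠ 0 ∧ η ≠ 0 ∧ σ' ≠ 0 ∧
    q = covector₃ s σ y η s' σ'}

/-- `Λ̃ = {(s, σ, y, η, s', σ') : (s - s', σ, y, η) ∈ Λ, σ = -σ'}`. -/
def lagTilde (Λ : Set (Cotangent (I₂ d) (ℝ × X))) : Set (Cotangent (I₃ d) ((ℝ × X) × ℝ)) :=
  {q | ∃ s σ, ∃ (y : X) (η : TangentSpace (𝓡 d) y →L[ℝ] ℝ), ∃ s' σ',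
    q = covector₃ s σ y η s' σ' ∧ covector₂ (s - s') σ y η ∈ Λ ∧ σ = -σ'}

end Translate

end LagDist

/-! Everything becomes a product in the coordinates `κ.pull`, that is `(z, t)` with `z = κ(s - s',
y)` and `t = s'`. There `A(s - s', y)` is `A ⊗ 1`, constant in `t`. Moving `t` with `z` fixed moves
`s` and `s'` together, so the covariable `τ` dual to `t` is `σ + σ'`. Hence `Λ̃` becomes the set of
`(z, t, ζ, τ)` with `(z, ζ)` in the local expression of `Λ` and `τ = 0`: the product of `Λ` with the
zero section of `T*ℝ` (`mem_inCoord_pull_iff`). The Lagrangian property and closedness are then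
inherited from `Λ` (`IsLagrangianNear.restrictCovector_preimage`, `IsClosedIn.lagTilde`).

For the distribution, a phase `φ(z, θ)` parametrizing a part of `Λ`, read as a function of `(z, t,
θ)`, is still non-degenerate and parametrizes the corresponding part of `Λ̃`. Neither `N` nor the
symbol order changes while the dimension `n` grows by one, and `m + (n - 2N)/4 = (m - 1/4) + (n + 1
- 2N)/4`; this is the loss of `1/4`. Since amplitudes must have compact base support, `a` is
multiplied by a cut-off `ρ(t)` equal to 1 near the given point (`IsLagrangianAmplitude.pull`). By
Fubini, pairing with `ψ(z, t)` is pairing the original integral with `∫ ψ(z, t) dt`, which is how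
`translate` is defined (`IsOscillatoryIntegral.comp_dropParam`, `MemLagrangian.translate`). -/

namespace LagDist

/-! ### Product of a Lagrangian with the zero section of `T*ℝ` -/

section RestrictCovector

variable (E : Type) [NormedAddCommGroup E] [NormedSpace ℝ E]

/-- The map `((z, t), ζ dz + τ dt) ↦ (z, ζ dz)`. -/
noncomputable def restrictCovector :
    ((E × ℝ) × (E × ℝ →L[ℝ] ℝ)) →L[ℝ] E × (E →L[ℝ] ℝ) :=
  ((ContinuousLinearMap.fst ℝ E ℝ).comp (ContinuousLinearMap.fst ℝ _ _)).prod
    (((ContinuousLinearMap.compL ℝ E (E × ℝ) ℝ).flip (ContinuousLinearMap.inl ℝ E ℝ)).comp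
      (ContinuousLinearMap.snd ℝ _ _))

/-- The map `((z, t), ζ dz + τ dt) ↦ τ`. -/
noncomputable def verticalPart : ((E × ℝ) × (E × ℝ →L[ℝ] ℝ)) →L[ℝ] ℝ :=
  (ContinuousLinearMap.apply ℝ ℝ ((0, 1) : E × ℝ)).comp (ContinuousLinearMap.snd ℝ _ _)

variable {E}

theorem restrictCovector_apply (p : (E × ℝ) × (E × ℝ →L[ℝ] ℝ)) :
    restrictCovector E p = (p.1.1, p.2.comp (ContinuousLinearMap.inl ℝ E ℝ)) := rfl

theorem verticalPart_apply (p : (E × ℝ) × (E × ℝ →L[ℝ] ℝ)) :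
    verticalPart E p = p.2 (0, 1) := rfl

theorem apply_eq_of_verticalPart_eq_zero {p : (E × ℝ) × (E × ℝ →L[ℝ] ℝ)}
    (hp : verticalPart E p = 0) (v : E × ℝ) : p.2 v = (restrictCovector E p).2 v.1 := by
  have h : v = (v.1, 0) + v.2 • ((0, 1) : E × ℝ) := by ext <;> simp
  rw [verticalPart_apply] at hp
  conv_lhs => rw [h, map_add, map_smul, hp]
  simp [restrictCovector_apply]

theorem exists_restrictCovector_eq (q : E × (E →L[ℝ] ℝ)) (τ : ℝ) :
    ∃ p, restrictCovector E p = q ∧ verticalPart E p = τ := by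
  refine ⟨((q.1, 0), q.2.comp (ContinuousLinearMap.fst ℝ E ℝ) +
    τ • ContinuousLinearMap.snd ℝ E ℝ), ?_, ?_⟩
  · rw [restrictCovector_apply]
    refine Prod.ext rfl ?_
    ext v
    simp
  · simp [verticalPart_apply]

/-- If `f` defines `S`, then `(f ∘ restrictCovector, τ)` defines the new set, and it is a submersion
because `restrictCovector` and `τ` can be prescribed independently. Tangent vectors have zero
`τ`-component, so the term `dτ ∧ dt` drops out and the symplectic form reduces to that of `E × E*`.
-/
theorem IsLagrangianNear.restrictCovector_preimage {S : Set (E × (E →L[ℝ] ℝ))}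
    {p : (E × ℝ) × (E × ℝ →L[ℝ] ℝ)} (h : IsLagrangianNear S (restrictCovector E p)) :
    IsLagrangianNear {q | restrictCovector E q ∈ S ∧ verticalPart E q = 0} p := by
  obtain ⟨W, f, hW, hpW, hf, hsurj, hS, hω⟩ := h
  have hD : ∀ q ∈ restrictCovector E ⁻¹' W,
      fderiv ℝ (fun q => (f (restrictCovector E q), verticalPart E q)) q =
        ((fderiv ℝ f (restrictCovector E q)).comp (restrictCovector E)).prod
          (verticalPart E) := by
    intro q hq
    have h1 : HasFDerivAt f (fderiv ℝ f (restrictCovector E q)) (restrictCovector E q) :=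
      ((hf.contDiffAt (hW.mem_nhds hq)).differentiableAt (by simp)).hasFDerivAt
    exact ((h1.comp q (restrictCovector E).hasFDerivAt).prodMk
      (verticalPart E).hasFDerivAt).fderiv
  refine ⟨restrictCovector E ⁻¹' W, fun q => (f (restrictCovector E q), verticalPart E q),
    hW.preimage (restrictCovector E).continuous, hpW, ?_, fun q hq => ?_, fun q hq => ?_,
    fun q hq v w hv hw => ?_⟩
  · exact (hf.comp (restrictCovector E).contDiff.contDiffOn fun q hq => hq).prodMk
      (verticalPart E).contDiff.contDiffOn
  · rw [hD q hq]
    rintro ⟨e, τ⟩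
    obtain ⟨u, rfl⟩ := hsurj _ hq e
    obtain ⟨r, rfl, rfl⟩ := exists_restrictCovector_eq u τ
    exact ⟨r, rfl⟩
  · rw [Prod.mk_eq_zero, ← hS _ hq]
    rfl
  · rw [hD q hq.1] at hv hw
    have hv' := Prod.mk_eq_zero.1 hv
    have hw' := Prod.mk_eq_zero.1 hw
    rw [apply_eq_of_verticalPart_eq_zero hv'.2, apply_eq_of_verticalPart_eq_zero hw'.2]
    exact hω _ ⟨hq.1, hq.2.1⟩ _ _ hv'.1 hw'.1

end RestrictCovector

/-! ### `Λ̃` in pulled-back coordinates -/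

section CovectorForm

variable {d : ℕ} {X : Type*} [TopologicalSpace X] [ChartedSpace (Ed d) X]

/-- The linear form underlying a point of `T*(ℝ × X)`. -/
def form₂ (q : Cotangent (I₂ d) (ℝ × X)) : ℝ × Ed d →L[ℝ] ℝ := q.2

/-- The linear form underlying a point of `T*(ℝ × X × ℝ)`. -/
def form₃ (q : Cotangent (I₃ d) ((ℝ × X) × ℝ)) : (ℝ × Ed d) × ℝ →L[ℝ] ℝ := q.2

/-- The covector with linear form `ξ` at the point `p` of `ℝ × X`. -/
def ofForm₂ (p : ℝ × X) (ξ : ℝ × Ed d →L[ℝ] ℝ) : Cotangent (I₂ d) (ℝ × X) := ⟨p, ξ⟩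

/-- The covector with linear form `ξ` at the point `p` of `ℝ × X × ℝ`. -/
def ofForm₃ (p : (ℝ × X) × ℝ) (ξ : (ℝ × Ed d) × ℝ →L[ℝ] ℝ) :
    Cotangent (I₃ d) ((ℝ × X) × ℝ) := ⟨p, ξ⟩

theorem form₂_covector₂ (s σ : ℝ) (y : X) (η : TangentSpace (𝓡 d) y →L[ℝ] ℝ) (v : ℝ × Ed d) :
    form₂ (covector₂ s σ y η) v = σ * v.1 + η v.2 := rfl

theorem form₃_covector₃ (s σ : ℝ) (y : X) (η : TangentSpace (𝓡 d) y →L[ℝ] ℝ) (s' σ' : ℝ)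
    (v : (ℝ × Ed d) × ℝ) :
    form₃ (covector₃ s σ y η s' σ') v = σ * v.1.1 + η v.1.2 + σ' * v.2 := rfl

theorem cotangent₂_ext {q r : Cotangent (I₂ d) (ℝ × X)} (h1 : q.1 = r.1)
    (h2 : form₂ q = form₂ r) : q = r := by
  obtain ⟨q1, q2⟩ := q
  obtain ⟨r1, r2⟩ := r
  obtain rfl : q1 = r1 := h1
  exact Sigma.ext rfl (heq_of_eq h2)

theorem cotangent₃_ext {q r : Cotangent (I₃ d) ((ℝ × X) × ℝ)} (h1 : q.1 = r.1)
    (h2 : form₃ q = form₃ r) : q = r := by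
  obtain ⟨q1, q2⟩ := q
  obtain ⟨r1, r2⟩ := r
  obtain rfl : q1 = r1 := h1
  exact Sigma.ext rfl (heq_of_eq h2)

theorem eq_covector₂ (q : Cotangent (I₂ d) (ℝ × X)) :
    q = covector₂ q.1.1 (form₂ q (1, 0)) q.1.2
      ((form₂ q).comp (ContinuousLinearMap.inr ℝ ℝ (Ed d))) := by
  refine cotangent₂_ext rfl (ContinuousLinearMap.ext fun v => ?_)
  rw [form₂_covector₂]
  have h : v = v.1 • ((1, 0) : ℝ × Ed d) + (0, v.2) := by ext <;> simp
  conv_lhs => rw [h, map_add, map_smul, smul_eq_mul, mul_comm]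
  rfl

theorem eq_covector₃ (q : Cotangent (I₃ d) ((ℝ × X) × ℝ)) :
    q = covector₃ q.1.1.1 (form₃ q ((1, 0), 0)) q.1.1.2
      (((form₃ q).comp (ContinuousLinearMap.inl ℝ (ℝ × Ed d) ℝ)).comp
        (ContinuousLinearMap.inr ℝ ℝ (Ed d))) q.1.2 (form₃ q (0, 1)) := by
  refine cotangent₃_ext rfl (ContinuousLinearMap.ext fun v => ?_)
  rw [form₃_covector₃]
  have h : v = v.1.1 • (((1, 0), 0) : (ℝ × Ed d) × ℝ) + ((0, v.1.2), 0) +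
    v.2 • (((0, 0), 1) : (ℝ × Ed d) × ℝ) := by ext <;> simp
  conv_lhs => rw [h, map_add, map_add, map_smul, map_smul, smul_eq_mul, smul_eq_mul,
    mul_comm, mul_comm v.2]
  rfl

theorem mem_nonzero₂_iff (q : Cotangent (I₂ d) (ℝ × X)) :
    q ∈ nonzero₂ d X ↔ form₂ q (1, 0) ≠ 0 ∧
      (form₂ q).comp (ContinuousLinearMap.inr ℝ ℝ (Ed d)) ≠ 0 := by
  constructor
  · rintro ⟨s, σ, y, η, hσ, hη, rfl⟩
    refine ⟨?_, fun h => hη (ContinuousLinearMap.ext fun v => ?_)⟩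
    · have h0 : η (0 : Ed d) = 0 := map_zero η
      rw [form₂_covector₂, h0]
      simpa using hσ
    · have h0 : σ * (0 : ℝ) + η v = 0 := DFunLike.congr_fun h v
      rwa [mul_zero, zero_add] at h0
  · rintro ⟨h1, h2⟩
    exact ⟨_, _, _, _, h1, h2, eq_covector₂ q⟩

theorem mem_nonzero₃_iff (q : Cotangent (I₃ d) ((ℝ × X) × ℝ)) :
    q ∈ nonzero₃ d X ↔ form₃ q ((1, 0), 0) ≠ 0 ∧
      ((form₃ q).comp (ContinuousLinearMap.inl ℝ (ℝ × Ed d) ℝ)).comp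
        (ContinuousLinearMap.inr ℝ ℝ (Ed d)) ≠ 0 ∧ form₃ q (0, 1) ≠ 0 := by
  constructor
  · rintro ⟨s, σ, y, η, s', σ', hσ, hη, hσ', rfl⟩
    have h0 : η (0 : Ed d) = 0 := map_zero η
    refine ⟨?_, fun h => hη (ContinuousLinearMap.ext fun v => ?_), ?_⟩
    · rw [form₃_covector₃, h0]
      simpa using hσ
    · have h1 : σ * (0 : ℝ) + η v + σ' * (0 : ℝ) = 0 := DFunLike.congr_fun h v
      rwa [mul_zero, mul_zero, zero_add, add_zero] at h1
    · rw [form₃_covector₃, Prod.snd_zero, h0]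
      simpa using hσ'
  · rintro ⟨h1, h2, h3⟩
    exact ⟨_, _, _, _, _, _, h1, h2, h3, eq_covector₃ q⟩

/-- Trades the existential splitting into `(s, σ, y, η, s', σ')` for conditions on the linear form
itself, which can be transported through coordinate systems. -/
theorem mem_lagTilde_iff (Λ : Set (Cotangent (I₂ d) (ℝ × X)))
    (q : Cotangent (I₃ d) ((ℝ × X) × ℝ)) :
    q ∈ lagTilde Λ ↔
      ofForm₂ (shear X q.1).1 ((form₃ q).comp (ContinuousLinearMap.inl ℝ (ℝ × Ed d) ℝ)) ∈ Λ ∧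
        form₃ q ((1, 0), 0) + form₃ q (0, 1) = 0 := by
  constructor
  · rintro ⟨s, σ, y, η, s', σ', rfl, h, hσ⟩
    have h0 : η (0 : Ed d) = 0 := map_zero η
    refine ⟨?_, ?_⟩
    · convert h using 1
      refine cotangent₂_ext rfl (ContinuousLinearMap.ext fun v => ?_)
      change form₃ (covector₃ s σ y η s' σ') (v, 0) = _
      rw [form₃_covector₃, form₂_covector₂]
      simp
    · rw [form₃_covector₃, form₃_covector₃, Prod.snd_zero, h0]
      simp [hσ]
  · rintro ⟨h1, h2⟩
    refine ⟨_, _, _, _, _, _, eq_covector₃ q, ?_, eq_neg_of_add_eq_zero_left h2⟩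
    rw [eq_covector₂ (ofForm₂ _ _)] at h1
    exact h1

/-- The derivative of a coordinate system of `ℝ × X`. -/
noncomputable def Coord.deriv₂ (κ : Coord (I₂ d) (ℝ × X)) (p : ℝ × X) :
    ℝ × Ed d →L[ℝ] ℝ × Ed d :=
  mfderiv (I₂ d) 𝓘(ℝ, ℝ × Ed d) κ.chart p

/-- The derivative of a coordinate system of `ℝ × X × ℝ`. -/
noncomputable def Coord.deriv₃ (κ : Coord (I₃ d) ((ℝ × X) × ℝ)) (p : (ℝ × X) × ℝ) :
    (ℝ × Ed d) × ℝ →L[ℝ] (ℝ × Ed d) × ℝ :=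
  mfderiv (I₃ d) 𝓘(ℝ, (ℝ × Ed d) × ℝ) κ.chart p

theorem mem_inCoord₂_iff (κ : Coord (I₂ d) (ℝ × X)) (Λ : Set (Cotangent (I₂ d) (ℝ × X)))
    (p : (ℝ × Ed d) × (ℝ × Ed d →L[ℝ] ℝ)) :
    p ∈ inCoord κ Λ ↔ p.1 ∈ κ.chart.target ∧
      ofForm₂ (κ.chart.symm p.1) (p.2.comp (κ.deriv₂ (κ.chart.symm p.1))) ∈ Λ := Iff.rfl

theorem mem_inCoord₃_iff (κ : Coord (I₃ d) ((ℝ × X) × ℝ))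
    (Λ : Set (Cotangent (I₃ d) ((ℝ × X) × ℝ)))
    (p : ((ℝ × Ed d) × ℝ) × ((ℝ × Ed d) × ℝ →L[ℝ] ℝ)) :
    p ∈ inCoord κ Λ ↔ p.1 ∈ κ.chart.target ∧
      ofForm₃ (κ.chart.symm p.1) (p.2.comp (κ.deriv₃ (κ.chart.symm p.1))) ∈ Λ := Iff.rfl

theorem Coord.deriv₃_pull (κ : Coord (I₂ d) (ℝ × X)) {p : (ℝ × X) × ℝ}
    (hp : (shear X p).1 ∈ κ.chart.source) (v : (ℝ × Ed d) × ℝ) :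
    κ.pull.deriv₃ p v = (κ.deriv₂ (shear X p).1 (v.1.1 - v.2, v.1.2), v.2) := by
  have hfst : HasMFDerivAt (I₃ d) (I₂ d) (Prod.fst : (ℝ × X) × ℝ → ℝ × X) p
      (ContinuousLinearMap.fst ℝ (ℝ × Ed d) ℝ) := hasMFDerivAt_fst p
  have hsnd : HasMFDerivAt (I₃ d) 𝓘(ℝ, ℝ) (Prod.snd : (ℝ × X) × ℝ → ℝ) p
      (ContinuousLinearMap.snd ℝ (ℝ × Ed d) ℝ) := hasMFDerivAt_snd p
  have hs : HasMFDerivAt (I₃ d) 𝓘(ℝ, ℝ) (fun p : (ℝ × X) × ℝ => p.1.1) p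
      ((ContinuousLinearMap.fst ℝ ℝ (Ed d)).comp (ContinuousLinearMap.fst ℝ (ℝ × Ed d) ℝ)) :=
    (hasMFDerivAt_fst (I := 𝓘(ℝ, ℝ)) (I' := 𝓡 d) p.1).comp p hfst
  have hy : HasMFDerivAt (I₃ d) (𝓡 d) (fun p : (ℝ × X) × ℝ => p.1.2) p
      ((ContinuousLinearMap.snd ℝ ℝ (Ed d)).comp (ContinuousLinearMap.fst ℝ (ℝ × Ed d) ℝ)) :=
    (hasMFDerivAt_snd (I := 𝓘(ℝ, ℝ)) (I' := 𝓡 d) p.1).comp p hfst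
  have hshear : HasMFDerivAt (I₃ d) (I₂ d) (fun p => (shear X p).1) p _ :=
    (hs.sub hsnd).prodMk hy
  have hκ : HasMFDerivAt (I₂ d) 𝓘(ℝ, ℝ × Ed d) κ.chart (shear X p).1
      (κ.deriv₂ (shear X p).1) :=
    ((κ.smooth.contMDiffAt (κ.chart.open_source.mem_nhds hp)).mdifferentiableAt
      (by simp)).hasMFDerivAt
  have h := hκ.comp p hshear
  -- Assembled from its continuity and derivative components, because the target carries the model
  -- of the single vector space `(ℝ × Ed d) × ℝ` and not a product of models.
  have h' : HasMFDerivAt (I₃ d) 𝓘(ℝ, (ℝ × Ed d) × ℝ) κ.pull.chart p _ :=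
    ⟨h.1.prodMk hsnd.1, h.2.prodMk hsnd.2⟩
  rw [Coord.deriv₃, h'.mfderiv]
  rfl

/-- By `Coord.deriv₃_pull`, vectors `(v, 0)` go to `(Dκ v, 0)`, so restricting to them commutes with
the change of coordinates, while `∂_s + ∂_{s'}` goes to `(0, 1)`, so `σ + σ'` is the vertical part.
-/
theorem mem_inCoord_pull_iff (κ : Coord (I₂ d) (ℝ × X)) (Λ : Set (Cotangent (I₂ d) (ℝ × X)))
    (p : ((ℝ × Ed d) × ℝ) × ((ℝ × Ed d) × ℝ →L[ℝ] ℝ)) :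
    p ∈ inCoord κ.pull (lagTilde Λ) ↔
      restrictCovector (ℝ × Ed d) p ∈ inCoord κ Λ ∧ verticalPart (ℝ × Ed d) p = 0 := by
  obtain ⟨⟨z, t⟩, ζ⟩ := p
  have hbase : (shear X (κ.pull.chart.symm (z, t))).1 = κ.chart.symm z := by
    simp [κ.pull_symm_apply]
  rw [mem_inCoord₃_iff, mem_inCoord₂_iff, κ.mem_pull_target, and_assoc]
  refine and_congr_right fun hz => ?_
  have hsrc : (shear X (κ.pull.chart.symm (z, t))).1 ∈ κ.chart.source := by
    rw [hbase]
    exact κ.chart.map_target hz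
  have hD : ∀ v, form₃ (ofForm₃ (κ.pull.chart.symm (z, t))
      (ζ.comp (κ.pull.deriv₃ (κ.pull.chart.symm (z, t))))) v =
      ζ (κ.deriv₂ (κ.chart.symm z) (v.1.1 - v.2, v.1.2), v.2) := by
    intro v
    rw [← hbase, ← κ.deriv₃_pull hsrc]
    rfl
  rw [mem_lagTilde_iff]
  refine and_congr (iff_of_eq ?_) ?_
  · congr 1
    refine cotangent₂_ext hbase (ContinuousLinearMap.ext fun v => ?_)
    refine (hD (v, 0)).trans ?_
    simp only [sub_zero]
    rfl
  · rw [← map_add, hD, verticalPart_apply]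
    simp [Prod.mk_zero_zero]

theorem inCoord_pull_lagTilde (κ : Coord (I₂ d) (ℝ × X))
    (Λ : Set (Cotangent (I₂ d) (ℝ × X))) :
    inCoord κ.pull (lagTilde Λ) =
      {p | restrictCovector (ℝ × Ed d) p ∈ inCoord κ Λ ∧ verticalPart (ℝ × Ed d) p = 0} :=
  Set.ext (mem_inCoord_pull_iff κ Λ)

/-! ### Lagrangian property and closedness of `Λ̃` -/

theorem IsConicLagrangian.lagTilde {Λ : Set (Cotangent (I₂ d) (ℝ × X))}
    (hΛ : IsConicLagrangian Λ) : IsConicLagrangian (lagTilde Λ) where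
  nonzero := by
    intro q hq h0
    refine hΛ.nonzero ((mem_lagTilde_iff Λ q).1 hq).1 ?_
    have h0' : form₃ q = 0 := h0
    rw [h0']
    exact ContinuousLinearMap.zero_comp _
  conic := by
    intro x ξ r hr hx
    rw [mem_lagTilde_iff] at hx ⊢
    refine ⟨hΛ.conic _ _ r hr hx.1, ?_⟩
    change r * form₃ ⟨x, ξ⟩ _ + r * form₃ ⟨x, ξ⟩ _ = 0
    rw [← mul_add, hx.2, mul_zero]
  lagrangian := by
    intro q hq
    obtain ⟨κ, hκ, h⟩ := hΛ.lagrangian _ ((mem_lagTilde_iff Λ q).1 hq).1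
    refine ⟨κ.pull, ⟨hκ, mem_univ _⟩, fun p hp hpq => ?_⟩
    rw [inCoord_pull_lagTilde]
    refine (h _ ((mem_inCoord_pull_iff κ Λ p).1 hp).1 ?_).restrictCovector_preimage
    change _ = (shear X q.1).1
    rw [← hpq]
    simp [κ.pull_symm_apply, restrictCovector_apply]

/-- The condition `τ = 0` is closed and `restrictCovector` is continuous, so a limit point of `Λ̃`
has `τ = 0` and restricts to a limit point of `Λ`. The hypothesis `hW` places this restriction in
`W`, where `Λ` is closed; it lets one argument serve both ambient sets of the theorem. -/
theorem IsClosedIn.lagTilde {Λ W : Set (Cotangent (I₂ d) (ℝ × X))}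
    {W' : Set (Cotangent (I₃ d) ((ℝ × X) × ℝ))} (h : IsClosedIn Λ W)
    (hsub : LagDist.lagTilde Λ ⊆ W')
    (hW : ∀ q ∈ W', form₃ q ((1, 0), 0) + form₃ q (0, 1) = 0 → q ∈ LagDist.lagTilde W) :
    IsClosedIn (LagDist.lagTilde Λ) W' := by
  refine ⟨hsub, fun x => ?_⟩
  obtain ⟨κ, hκ, hcl⟩ := h.2 (shear X x).1
  refine ⟨κ.pull, ⟨hκ, mem_univ _⟩, fun p hp hpc => ?_⟩
  rw [inCoord_pull_lagTilde] at hpc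
  have hv : verticalPart (ℝ × Ed d) p = 0 :=
    closure_minimal (fun q hq => hq.2)
      (isClosed_eq (verticalPart (ℝ × Ed d)).continuous continuous_const) hpc
  have hr : restrictCovector (ℝ × Ed d) p ∈ closure (inCoord κ Λ) :=
    map_mem_closure (restrictCovector (ℝ × Ed d)).continuous hpc fun q hq => hq.1
  have hpW : p ∈ inCoord κ.pull (LagDist.lagTilde W) := by
    refine ⟨hp.1, hW _ hp.2 ?_⟩
    have hsrc : (shear X (κ.pull.chart.symm p.1)).1 ∈ κ.chart.source :=
      (κ.pull.chart.map_target hp.1).1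
    -- The sum `σ + σ'` is the value of the covector on `((1, 0), 1)`, whose image under the
    -- derivative of `κ.pull` is `(0, 1)`.
    rw [← map_add]
    change p.2 (κ.pull.deriv₃ _ _) = 0
    rw [κ.deriv₃_pull hsrc]
    rw [verticalPart_apply] at hv
    simpa [Prod.mk_zero_zero] using hv
  rw [mem_inCoord_pull_iff] at hpW ⊢
  exact ⟨hcl _ hpW.1 hr, hv⟩

theorem lagTilde_subset_nonzero₃ {Λ : Set (Cotangent (I₂ d) (ℝ × X))}
    (h : Λ ⊆ nonzero₂ d X) : lagTilde Λ ⊆ nonzero₃ d X := by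
  intro q hq
  rw [mem_lagTilde_iff] at hq
  have h2 := (mem_nonzero₂_iff _).1 (h hq.1)
  refine (mem_nonzero₃_iff q).2 ⟨h2.1, h2.2, fun h3 => h2.1 ?_⟩
  change form₃ q ((1, 0), 0) = 0
  have h4 := hq.2
  rwa [h3, add_zero] at h4

theorem mem_lagTilde_nonzero₂ {q : Cotangent (I₃ d) ((ℝ × X) × ℝ)} (hq : q ∈ nonzero₃ d X)
    
    (h : form₃ q ((1, 0), 0) + form₃ q (0, 1) = 0) : q ∈ lagTilde (nonzero₂ d X) := by
  have h3 := (mem_nonzero₃_iff q).1 hq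
  exact (mem_lagTilde_iff _ q).2 ⟨(mem_nonzero₂_iff _).2 ⟨h3.1, h3.2.1⟩, h⟩

/-- If `σ ds + η` vanished, then `σ = 0`, hence `σ' = -σ = 0` and the whole covector would vanish.
-/
theorem mem_lagTilde_nonzeroCotangent {q : Cotangent (I₃ d) ((ℝ × X) × ℝ)}
    (hq : q ∈ nonzeroCotangent (I₃ d) ((ℝ × X) × ℝ)) 
    (h : form₃ q ((1, 0), 0) + form₃ q (0, 1) = 0) :
    q ∈ lagTilde (nonzeroCotangent (I₂ d) (ℝ × X)) := by
  refine (mem_lagTilde_iff _ q).2 ⟨fun h0 => hq ?_, h⟩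
  have h0' : ∀ v : ℝ × Ed d, form₃ q (v, 0) = 0 := fun v =>
    DFunLike.congr_fun (show (form₃ q).comp (ContinuousLinearMap.inl ℝ (ℝ × Ed d) ℝ) = 0 from h0) v
  have h1 : form₃ q (0, 1) = 0 := by simpa [h0'] using h
  change form₃ q = 0
  refine ContinuousLinearMap.ext fun v : (ℝ × Ed d) × ℝ => ?_
  have hv : v = (v.1, 0) + v.2 • ((0, 1) : (ℝ × Ed d) × ℝ) := by ext <;> simp
  rw [hv, map_add, map_smul, h0', h1]
  simp

end CovectorForm

/-! ### Phase functions independent of the extra variable -/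

section DropParam

variable (E F : Type) [NormedAddCommGroup E] [NormedSpace ℝ E]
  [NormedAddCommGroup F] [NormedSpace ℝ F]

/-- The projection `((z, t), θ) ↦ (z, θ)`. -/
noncomputable def dropParam : ((E × ℝ) × F) →L[ℝ] E × F :=
  (ContinuousLinearMap.fst ℝ E ℝ).prodMap (ContinuousLinearMap.id ℝ F)

variable {E F}

theorem dropParam_apply (p : (E × ℝ) × F) : dropParam E F p = (p.1.1, p.2) := rfl

variable (E F) in
theorem dropParam_surjective : Function.Surjective (dropParam E F) :=
  fun q => ⟨((q.1, 0), q.2), rfl⟩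

variable {N : ℕ} {Γ : Set (E × EuclideanSpace ℝ (Fin N))}
  {φ : E × EuclideanSpace ℝ (Fin N) → ℝ}

theorem IsNondegeneratePhase.fderiv_comp_dropParam (h : IsNondegeneratePhase Γ φ)
    {p : (E × ℝ) × EuclideanSpace ℝ (Fin N)} (hp : dropParam E _ p ∈ Γ) :
    fderiv ℝ (φ ∘ dropParam E _) p = (fderiv ℝ φ (dropParam E _ p)).comp (dropParam E _) :=
  ((((h.smooth.contDiffAt (h.isOpen.mem_nhds hp)).differentiableAt (by simp)).hasFDerivAt).comp p
    (dropParam E (EuclideanSpace ℝ (Fin N))).hasFDerivAt).fderiv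

theorem IsNondegeneratePhase.dTheta_comp_dropParam (h : IsNondegeneratePhase Γ φ)
    {p : (E × ℝ) × EuclideanSpace ℝ (Fin N)} (hp : dropParam E _ p ∈ Γ) :
    dTheta (φ ∘ dropParam E _) p = dTheta φ (dropParam E _ p) := by
  rw [dTheta, h.fderiv_comp_dropParam hp]
  rfl

theorem IsNondegeneratePhase.dBase_comp_dropParam (h : IsNondegeneratePhase Γ φ)
    {p : (E × ℝ) × EuclideanSpace ℝ (Fin N)} (hp : dropParam E _ p ∈ Γ) :
    dBase (φ ∘ dropParam E _) p =
      (dBase φ (dropParam E _ p)).comp (ContinuousLinearMap.fst ℝ E ℝ) := by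
  rw [dBase, h.fderiv_comp_dropParam hp]
  rfl

/-- Derivatives of the new phase are those of `φ` composed with the surjection `dropParam`, which
preserves both being nonzero and being surjective. -/
theorem IsNondegeneratePhase.comp_dropParam (h : IsNondegeneratePhase Γ φ) :
    IsNondegeneratePhase (dropParam E _ ⁻¹' Γ) (φ ∘ dropParam E _) where
  isOpen := h.isOpen.preimage (dropParam E _).continuous
  ne_zero p hp := h.ne_zero _ hp
  conic p hp := h.conic _ hp
  smooth := h.smooth.comp (dropParam E (EuclideanSpace ℝ (Fin N))).contDiff.contDiffOn
    fun _ hp => hp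
  homogeneous p hp := h.homogeneous _ hp
  no_critical p hp h0 := by
    refine h.no_critical _ hp (ContinuousLinearMap.ext fun v => ?_)
    obtain ⟨w, rfl⟩ := dropParam_surjective E _ v
    rw [h.fderiv_comp_dropParam hp] at h0
    exact DFunLike.congr_fun h0 w
  nondegenerate p hp h0 := by
    rw [h.dTheta_comp_dropParam hp] at h0
    have hsm : ContDiffAt ℝ ∞ (dTheta φ) (dropParam E _ p) := by
      have h1 : ContDiffAt ℝ ∞ (fderiv ℝ φ) (dropParam E _ p) :=
        (h.smooth.contDiffAt (h.isOpen.mem_nhds hp)).fderiv_right (by norm_cast)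
      exact h1.clm_comp contDiffAt_const
    have hev : dTheta (φ ∘ dropParam E _) =ᶠ[𝓝 p] dTheta φ ∘ dropParam E _ := by
      filter_upwards [(h.isOpen.preimage (dropParam E _).continuous).mem_nhds hp] with q hq
      exact h.dTheta_comp_dropParam hq
    rw [hev.fderiv_eq, ((hsm.differentiableAt (by simp)).hasFDerivAt.comp p
      (dropParam E (EuclideanSpace ℝ (Fin N))).hasFDerivAt).fderiv]
    exact (h.nondegenerate _ hp h0).comp (dropParam_surjective E _)

end DropParam

/-! ### Symbol estimates with a cut-off -/

section Symbol

variable {E : Type} [NormedAddCommGroup E] [NormedSpace ℝ E] {N : ℕ}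

/-- A fibre derivative is the full derivative of `a` restricted to fibre directions, and that
restriction is a continuous linear operation independent of `x`. -/
theorem contDiff_iteratedFDeriv_fibre {F G : Type} [NormedAddCommGroup F] [NormedSpace ℝ F]
    [NormedAddCommGroup G] [NormedSpace ℝ G] {a : E × F → G} (ha : ContDiff ℝ ∞ a) (k : ℕ)
    (θ : F) : ContDiff ℝ ∞ (fun x => iteratedFDeriv ℝ k (fun θ' => a (x, θ')) θ) := by
  have h : (fun x => iteratedFDeriv ℝ k (fun θ' => a (x, θ')) θ) = fun x =>
      ContinuousMultilinearMap.compContinuousLinearMapL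
        (fun _ : Fin k => ContinuousLinearMap.inr ℝ E F) (iteratedFDeriv ℝ k a (x, θ)) := by
    funext x
    have h1 : (fun θ' => a (x, θ')) =
        (fun p => a (p + (x, 0))) ∘ ContinuousLinearMap.inr ℝ E F := by
      funext θ'
      simp
    have h2 : ContDiff ℝ ∞ (fun p => a (p + (x, 0))) := ha.comp (by fun_prop)
    rw [h1, (ContinuousLinearMap.inr ℝ E F).iteratedFDeriv_comp_right h2 θ
      (by norm_cast; exact le_top), iteratedFDeriv_comp_add_right]
    simp
  rw [h]
  refine (ContinuousLinearMap.contDiff _).comp ?_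
  exact (ha.iteratedFDeriv_right (m := ∞) (by norm_cast)).comp (contDiff_prodMk_left θ)

theorem norm_iteratedFDeriv_comp_le_of_norm_le_one {E E' G : Type} [NormedAddCommGroup E]
    [NormedSpace ℝ E] [NormedAddCommGroup E'] [NormedSpace ℝ E'] [NormedAddCommGroup G]
    [NormedSpace ℝ G] {L : E' →L[ℝ] E} (hL : ‖L‖ ≤ 1) {f : E → G} (hf : ContDiff ℝ ∞ f)
    (x : E') (i : ℕ) : ‖iteratedFDeriv ℝ i (f ∘ L) x‖ ≤ ‖iteratedFDeriv ℝ i f (L x)‖ := by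
  rw [L.iteratedFDeriv_comp_right hf x (by norm_cast; exact le_top)]
  refine (ContinuousMultilinearMap.norm_compContinuousLinearMap_le _ _).trans ?_
  refine mul_le_of_le_one_right (norm_nonneg _) ?_
  exact Finset.prod_le_one (fun _ _ => norm_nonneg _) fun _ _ => hL

/-- The factor `ρ(t)` is constant in `θ`, so it passes through the fibre derivatives; the Leibniz
rule in `(z, t)` then costs only bounds on derivatives of `ρ` over a compact set. -/
theorem IsSymbol.mul_cutoff {μ : ℝ} {a : E × EuclideanSpace ℝ (Fin N) → ℂ} (ha : IsSymbol μ a)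
    {ρ : ℝ → ℝ} (hρ : ContDiff ℝ ∞ ρ) :
    IsSymbol μ (fun p : (E × ℝ) × EuclideanSpace ℝ (Fin N) => ρ p.1.2 • a (p.1.1, p.2)) := by
  refine ⟨(hρ.comp (by fun_prop)).smul (ha.1.comp (by fun_prop)), fun K hK j k => ?_⟩
  choose C hC using fun i => ha.2 (Prod.fst '' K) (hK.image continuous_fst) i k
  choose B hB using fun i => (hK.image continuous_snd).exists_bound_of_continuousOn
    (hρ.continuous_iteratedFDeriv (m := i) (by norm_cast; exact le_top)).continuousOn
  refine ⟨∑ i ∈ Finset.range (j + 1), (j.choose i : ℝ) * |B i| * C (j - i),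
    fun x hx θ => ?_⟩
  have hfun : (fun x' : E × ℝ => iteratedFDeriv ℝ k (fun θ' => ρ x'.2 • a (x'.1, θ')) θ) =
      fun x' => (ρ ∘ ContinuousLinearMap.snd ℝ E ℝ) x' •
        ((fun z => iteratedFDeriv ℝ k (fun θ' => a (z, θ')) θ) ∘
          ContinuousLinearMap.fst ℝ E ℝ) x' := by
    funext x'
    exact iteratedFDeriv_const_smul_apply (𝕜 := ℝ) (R := ℝ) (f := fun θ' => a (x'.1, θ'))
      (a := ρ x'.2) ((ha.1.comp (contDiff_prodMk_right x'.1)).contDiffAt.of_le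
        (by norm_cast; exact le_top))
  have hfst : ‖ContinuousLinearMap.fst ℝ E ℝ‖ ≤ 1 := ContinuousLinearMap.norm_fst_le ℝ E ℝ
  have hsnd : ‖ContinuousLinearMap.snd ℝ E ℝ‖ ≤ 1 := ContinuousLinearMap.norm_snd_le ℝ E ℝ
  have hG := contDiff_iteratedFDeriv_fibre ha.1 k θ
  rw [hfun, Finset.sum_mul]
  refine (norm_iteratedFDeriv_smul_le (N := ∞) (hρ.comp (ContinuousLinearMap.contDiff _))
    (hG.comp (ContinuousLinearMap.contDiff _)) x (by norm_cast; exact le_top)).trans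
    (Finset.sum_le_sum fun i _ => ?_)
  have h1 : ‖iteratedFDeriv ℝ i (ρ ∘ ContinuousLinearMap.snd ℝ E ℝ) x‖ ≤ |B i| :=
    (norm_iteratedFDeriv_comp_le_of_norm_le_one hsnd hρ x i).trans
      ((hB i _ ⟨x, hx, rfl⟩).trans (le_abs_self _))
  have h2 := (norm_iteratedFDeriv_comp_le_of_norm_le_one hfst hG x (j - i)).trans
      (hC (j - i) _ ⟨x, hx, rfl⟩ θ)
  rw [mul_assoc, mul_assoc, mul_assoc]
  exact mul_le_mul_of_nonneg_left (mul_le_mul h1 h2 (norm_nonneg _) (abs_nonneg _))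
    (Nat.cast_nonneg _)

end Symbol

/-! ### Fubini for the pairings -/

section Fubini

theorem continuous_of_continuousOn_of_eq_zero {E F : Type*} [TopologicalSpace E] [T2Space E]
    [TopologicalSpace F] [Zero F] {f : E → F} {U C : Set E} (hU : IsOpen U) (hC : IsCompact C)
    (hCU : C ⊆ U) (hf : ContinuousOn f U) (h0 : ∀ x ∉ C, f x = 0) : Continuous f := by
  refine continuous_iff_continuousAt.2 fun x => ?_
  by_cases hx : x ∈ U
  · exact hf.continuousAt (hU.mem_nhds hx)
  · have : f =ᶠ[𝓝 x] fun _ => 0 := by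
      filter_upwards [hC.isClosed.isOpen_compl.mem_nhds fun h => hx (hCU h)] with y hy
      exact h0 y hy
    exact this.continuousAt

/-- Nothing is known about `φ` outside `Γ`, but the exponential has modulus one, so the product
tends to zero wherever `a` does. -/
theorem continuous_exp_phase_mul {E : Type*} [TopologicalSpace E] {N : ℕ}
    {Γ : Set (E × EuclideanSpace ℝ (Fin N))}
    {φ : E × EuclideanSpace ℝ (Fin N) → ℝ} {a : E × EuclideanSpace ℝ (Fin N) → ℂ}
    (hΓ : IsOpen Γ) (hφ : ContinuousOn φ Γ) (ha : Continuous a) (h0 : ∀ p ∉ Γ, a p = 0) :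
    Continuous fun p => Complex.exp (Complex.I * (φ p : ℂ)) * a p := by
  refine continuous_iff_continuousAt.2 fun p => ?_
  by_cases hp : p ∈ Γ
  · have h1 : ContinuousAt φ p := hφ.continuousAt (hΓ.mem_nhds hp)
    exact ((continuousAt_const.mul (Complex.continuous_ofReal.continuousAt.comp h1)).cexp).mul
      ha.continuousAt
  · rw [ContinuousAt, h0 p hp, mul_zero, tendsto_zero_iff_norm_tendsto_zero]
    have h1 := ha.continuousAt (x := p)
    rw [ContinuousAt, h0 p hp, tendsto_zero_iff_norm_tendsto_zero] at h1
    refine h1.congr fun q => ?_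
    rw [norm_mul, mul_comm Complex.I, Complex.norm_exp_ofReal_mul_I, one_mul]

variable {E : Type} [NormedAddCommGroup E] [MeasureSpace E] [BorelSpace E]
  [SFinite (volume : Measure E)] [IsFiniteMeasureOnCompacts (volume : Measure E)]

theorem integral_mul_eq_integral_mul_fibreInt {F : E → ℂ} {ψ : E × ℝ → ℂ} {U : Set E}
    {C : Set (E × ℝ)} (hU : IsOpen U) (hC : IsCompact C) (hCU : C ⊆ U ×ˢ univ)
    (hF : ContinuousOn F U) (hψ : ContinuousOn ψ (U ×ˢ univ)) (h0 : ∀ p ∉ C, ψ p = 0) :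
    ∫ p : E × ℝ, F p.1 * ψ p = ∫ z : E, F z * fibreInt ψ z := by
  have h0' : ∀ p ∉ C, F p.1 * ψ p = 0 := fun p hp => by rw [h0 p hp, mul_zero]
  have hcont : Continuous fun p : E × ℝ => F p.1 * ψ p :=
    continuous_of_continuousOn_of_eq_zero (hU.prod isOpen_univ) hC hCU
      ((hF.comp continuousOn_fst fun p hp => hp.1).mul hψ) h0'
  have hint : Integrable (fun p : E × ℝ => F p.1 * ψ p)
      ((volume : Measure E).prod (volume : Measure ℝ)) :=
    hcont.integrable_of_hasCompactSupport (HasCompactSupport.intro hC h0')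
  rw [Measure.volume_eq_prod, integral_prod _ hint]
  refine integral_congr_ae (.of_forall fun z => ?_)
  exact integral_const_mul (F z) _

theorem IsOscillatoryIntegral.comp_dropParam [NormedSpace ℝ E] {N : ℕ}
    {Γ : Set (E × EuclideanSpace ℝ (Fin N))}
    {φ : E × EuclideanSpace ℝ (Fin N) → ℝ} {a : E × EuclideanSpace ℝ (Fin N) → ℂ}
    (hΓ : IsOpen Γ) (hφ : ContinuousOn φ Γ) (ha : Continuous a) (h0 : ∀ p ∉ Γ, a p = 0)
    {ψ : E × ℝ → ℂ} (hψ : Continuous ψ) (hψc : HasCompactSupport ψ) {ρ : ℝ → ℝ}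
    (hρ : ∀ p, ψ p ≠ 0 → ρ p.2 = 1) {c : ℂ}
    (h : IsOscillatoryIntegral φ a (fibreInt ψ) c) :
    IsOscillatoryIntegral (φ ∘ dropParam E _) (fun p => ρ p.1.2 • a (p.1.1, p.2)) ψ c := by
  intro χ hχ hχc hχ0
  -- The regularized integrals already agree for each `ε` and `θ`, so no limit is interchanged with
  -- an integral; the cut-off is invisible because `ρ = 1` where `ψ ≠ 0`.
  refine (h χ hχ hχc hχ0).congr fun ε => integral_congr_ae (.of_forall fun θ => ?_)
  have hF : Continuous fun z : E =>
      (χ (ε • θ) : ℂ) * (Complex.exp (Complex.I * (φ (z, θ) : ℂ)) * a (z, θ)) :=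
    continuous_const.mul ((continuous_exp_phase_mul hΓ hφ ha h0).comp (.prodMk_left θ))
  have hfub := integral_mul_eq_integral_mul_fibreInt isOpen_univ hψc (subset_univ _|>.trans
    univ_prod_univ.symm.subset) hF.continuousOn hψ.continuousOn
    fun p hp => image_eq_zero_of_notMem_tsupport hp
  refine Eq.trans (integral_congr_ae (.of_forall fun z => ?_))
    (hfub.symm.trans (integral_congr_ae (.of_forall fun p => ?_)))
  · simp only
    ring
  · by_cases hp : ψ p = 0
    · simp [hp]
    · simp only [Function.comp_apply, dropParam_apply, hρ p hp, one_smul]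
      ring

end Fubini

/-! ### The translated Lagrangian distribution -/

section Main

variable {d : ℕ} {X : Type*} [TopologicalSpace X] [ChartedSpace (Ed d) X]

theorem IsLagrangianAmplitude.pull {κ : Coord (I₂ d) (ℝ × X)} {m : ℝ}
    {Λ : Set (Cotangent (I₂ d) (ℝ × X))} {N : ℕ}
    {φ : (ℝ × Ed d) × EuclideanSpace ℝ (Fin N) → ℝ}
    {a : (ℝ × Ed d) × EuclideanSpace ℝ (Fin N) → ℂ} (h : IsLagrangianAmplitude κ m Λ N φ a)
    {ρ : ℝ → ℝ} (hρ : ContDiff ℝ ∞ ρ) (hρc : HasCompactSupport ρ) :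
    IsLagrangianAmplitude κ.pull (m - 1 / 4) (lagTilde Λ) N (φ ∘ dropParam (ℝ × Ed d) _)
      (fun p => ρ p.1.2 • a (p.1.1, p.2)) := by
  obtain ⟨Γ, hφ, htar, hΛ, ha, K, hK, hKΓ, hsupp⟩ := h
  refine ⟨dropParam _ _ ⁻¹' Γ, hφ.comp_dropParam, fun p hp => (κ.mem_pull_target _ _).2 (htar _ hp),
    fun p hp h0 => ?_, ?_, (fun q : ((ℝ × Ed d) × EuclideanSpace ℝ (Fin N)) × ℝ =>
      ((q.1.1, q.2), q.1.2)) '' (K ×ˢ tsupport ρ), (hK.prod hρc).image (by fun_prop), ?_,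
    fun p hp => ?_⟩
  · rw [hφ.dTheta_comp_dropParam hp] at h0
    rw [mem_inCoord_pull_iff, hφ.dBase_comp_dropParam hp]
    exact ⟨hΛ _ hp h0, map_zero (dBase φ _)⟩
  -- The dimension rises by one with `N` fixed, so `-1/4 + 1/4 = 0` and the symbol order is
  -- unchanged.
  · convert ha.mul_cutoff hρ using 1
    simp only [Module.finrank_prod, Module.finrank_self]
    push_cast
    ring
  · rintro _ ⟨⟨q, t⟩, ⟨hq, -⟩, rfl⟩
    exact hKΓ hq
  · obtain ⟨q, hq, t, ht, hqt⟩ := hsupp _ (right_ne_zero_of_smul hp)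
    -- Dilation acts on `θ` only, so the base point keeps its own last coordinate `p.1.2`, which
    -- lies in the support of `ρ`.
    refine ⟨((q.1, p.1.2), q.2), ⟨(q, p.1.2), ⟨hq, subset_tsupport ρ ?_⟩, rfl⟩, t, ht, ?_⟩
    · exact left_ne_zero_of_smul hp
    · have h1 := congrArg Prod.fst hqt
      have h2 := congrArg Prod.snd hqt
      exact Prod.ext (Prod.ext h1 rfl) h2

/-- The compact set is the image of `K`. Since coefficients are extended by zero, this upgrades
continuity on the coordinate range to continuity and compact support on all of `E`. -/
theorem IsHalfDensity.exists_isCompact_eq_zero {E : Type} [NormedAddCommGroup E] [NormedSpace ℝ E]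
    {H : Type} [TopologicalSpace H] {I : ModelWithCorners ℝ E H} {M : Type*} [TopologicalSpace M]
    [ChartedSpace H M] {f : Coord I M → E → ℂ} (hf : IsHalfDensity f) {K : Set M}
    (hfK : VanishesOff f K) (hK : IsCompact K) {κ : Coord I M} (hKκ : K ⊆ κ.chart.source) :
    ∃ C ⊆ κ.chart.target, IsCompact C ∧ ∀ z ∉ C, f κ z = 0 := by
  refine ⟨κ.chart '' K, ?_, hK.image_of_continuousOn (κ.chart.continuousOn.mono hKκ),
    fun z hz => ?_⟩
  · rintro _ ⟨x, hx, rfl⟩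
    exact κ.chart.map_source (hKκ hx)
  · by_cases hzt : z ∈ κ.chart.target
    · exact hfK κ z hzt fun h => hz ⟨_, h, κ.chart.right_inv hzt⟩
    · exact hf.zero_off κ z hzt

theorem MemLagrangian.translate {m : ℝ} {Λ : Set (Cotangent (I₂ d) (ℝ × X))}
    {A : DistHD (I₂ d) (ℝ × X)} (hA : MemLagrangian m Λ A) :
    MemLagrangian (m - 1 / 4) (lagTilde Λ) (translate A) := by
  intro x₀
  obtain ⟨κ, U, hU, hxU, hUκ, r, N, φ, a, g, hamp, hg, hform⟩ := hA (shear X x₀).1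
  -- Inner radius 1 matches the unit ball to which `s'` is confined below, so `ρ = 1` on the support
  -- of every admissible test density.
  let ρ : ContDiffBump x₀.2 := ⟨1, 2, one_pos, one_lt_two⟩
  refine ⟨κ.pull, (fun p => (shear X p).1) ⁻¹' U ∩ Prod.snd ⁻¹' Metric.ball x₀.2 1,
    (hU.preimage (by fun_prop)).inter (Metric.isOpen_ball.preimage continuous_snd),
    ⟨hxU, Metric.mem_ball_self one_pos⟩, fun p hp => ⟨hUκ hp.1, mem_univ _⟩, r, N,
    fun i => φ i ∘ dropParam _ _, fun i p => ρ p.1.2 • a i (p.1.1, p.2), fun p => g p.1,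
    fun i => (hamp i).pull ρ.contDiff ρ.hasCompactSupport, ?_, ?_⟩
  · exact hg.comp contDiff_fst.contDiffOn fun p hp => (κ.mem_pull_target p.1 p.2).1 hp
  · rintro ψ ⟨K, hKU, hK, hψK⟩
    have htar : κ.pull.chart.target = κ.chart.target ×ˢ univ := by
      ext ⟨z, t⟩
      simp [κ.mem_pull_target]
    obtain ⟨C, hC, hCc, hC0⟩ := ψ.2.1.exists_isCompact_eq_zero hψK hK (κ := κ.pull)
      fun p hp => ⟨hUκ (hKU hp).1, mem_univ _⟩
    have hψc : ContinuousOn (ψ.1 κ.pull) κ.pull.chart.target := (ψ.2.1.smooth κ.pull).continuousOn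
    obtain ⟨c, hc, hAc⟩ := hform (pushTest d X ψ) ⟨_, by
      rintro _ ⟨p, hp, rfl⟩
      exact (hKU hp).1, hK.image (by fun_prop), vanishesOff_fibreInt hψK⟩
    refine ⟨c, fun i => ?_, ?_⟩
    · obtain ⟨Γ, hφ, -, -, ha, L, -, hLΓ, hsupp⟩ := hamp i
      refine IsOscillatoryIntegral.comp_dropParam hφ.isOpen hφ.smooth.continuousOn
        ha.1.continuous (fun p hp => ?_)
        (continuous_of_continuousOn_of_eq_zero κ.pull.chart.open_target hCc hC hψc hC0)
        (HasCompactSupport.intro hCc hC0) (fun p hp => ?_) (hc i)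
      -- The support of `a` consists of dilates of points of a compact subset of `Γ`, and `Γ` is
      -- conic.
      · by_contra h0
        obtain ⟨q, hq, t, ht, rfl⟩ := hsupp p h0
        exact hp (hφ.conic q (hLΓ hq) t (by linarith))
      · have hpt : p ∈ κ.pull.chart.target := by
          by_contra h
          exact hp (ψ.2.1.zero_off _ _ h)
        refine ρ.one_of_mem_closedBall (Metric.ball_subset_closedBall ?_)
        have hpK : κ.pull.chart.symm p ∈ K := by
          by_contra h
          exact hp (hψK _ _ hpt h)
        exact (hKU hpK).2
    -- The smooth term carries no support condition, so it is extended constantly in `t` without a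
    -- cut-off, and only Fubini is needed.
    · refine hAc.trans ?_
      congr 1
      rw [htar] at hC hψc
      exact (integral_mul_eq_integral_mul_fibreInt κ.chart.open_target hCc hC
        hg.continuousOn hψc hC0).symm

end Main

end LagDist

theorem mainTheorem6 (d : ℕ) {X : Type*} [TopologicalSpace X] [T2Space X]
    [SecondCountableTopology X] [ChartedSpace (EuclideanSpace ℝ (Fin d)) X] [IsManifold (𝓡 d) ∞ X]
    (m : ℝ) (Λ : Set (LagDist.Cotangent (LagDist.I₂ d) (ℝ × X)))
    (hΛ : LagDist.IsConicLagrangian Λ) (hcl : LagDist.IsClosedIn Λ (LagDist.nonzero₂ d X))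
    (A : LagDist.DistHD (LagDist.I₂ d) (ℝ × X)) (hA : LagDist.MemLagrangian m Λ A) :
    LagDist.IsConicLagrangian (LagDist.lagTilde Λ) ∧
    LagDist.IsClosedIn (LagDist.lagTilde Λ) (LagDist.nonzero₃ d X) ∧
    (LagDist.IsClosedIn Λ (LagDist.nonzeroCotangent (LagDist.I₂ d) (ℝ × X)) →
      LagDist.IsClosedIn (LagDist.lagTilde Λ)
        (LagDist.nonzeroCotangent (LagDist.I₃ d) ((ℝ × X) × ℝ))) ∧
    LagDist.MemLagrangian (m - 1 / 4) (LagDist.lagTilde Λ) (LagDist.translate A) :=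
  ⟨hΛ.lagTilde,
    hcl.lagTilde (LagDist.lagTilde_subset_nonzero₃ hcl.1) fun _ => LagDist.mem_lagTilde_nonzero₂,
    fun h => h.lagTilde hΛ.lagTilde.nonzero fun _ => LagDist.mem_lagTilde_nonzeroCotangent,
    hA.translate⟩
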